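/- Let $\mathbb F_q$ be the field with $q$ elements, $q$ a prime power. A property $\mathcal P$ of linear codes in $\mathbb F_q^n$ is a set of linear subspaces of $\mathbb F_q^n$; a code satisfies $\mathcal P$ if it belongs to $\mathcal P$. The property is monotone-increasing if it is upward closed under containment; row-symmetric if it is closed under permuting the coordinates of a code; $b$-local ($b\in\mathbb N$) if there is a family $\mathcal B$ of subsets of $\mathbb F_q^n$, each of size at most $b$, such that $\mathcal C$ satisfies $\mathcal P$ if and only if $B\subseteq\mathcal C$ for some $B\in\mathcal B$; and scalar-invariant if $\mathcal C\in\mathcal P$ implies $\Lambda\mathcal C=\{\Lambda u: u\in \mathcal C\}\in\mathcal P$ for every full-rank diagonal matrix $\Lambda\in\mathbb F_q^{n\times n}$. For a nonempty monotone-increasing property $\mathcal P$ let $\mathrm{RLC}(\mathcal P)$ be the least $R\in[0,1]$, with $Rn$ an integer, such that a random linear code of rate $R$ (the row span of a uniformly random matrix in $\mathbb F_q^{Rn\times n}$) satisfies $\mathcal P$ with probability at least $\frac12$. A linear code $\mathcal D\subseteq\mathbb F_q^m$ has $\eta$-optimal distance if $\frac{|\{i: u_i\neq0\}|}{m}\ge\frac{(q-1)(1-\eta)}q$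 for every $u\in\mathcal D\setminus\{0\}$. A random $n$-puncturing of $\mathcal D$, where $m\ge 1$, is the code $\{(u_{i_1},\dots,u_{i_n}): u\in\mathcal D\}$ with $i_1,\dots,i_n$ independent and uniform in $\{1,\dots,m\}$; its design rate is $\frac{\log_q|\mathcal D|}{n}$. **Theorem.** Let $g:\mathbb N\to\mathbb R$ satisfy $g(n)\to\infty$. There is a function $\delta:\mathbb N\to\mathbb R$ with $\delta(n)\to0$ as $n\to\infty$, depending only on $g$, such that the following holds for every prime power $q$, all $n,b\in\mathbb N$ with $\frac{n}{\log n}\ge g(n)\,q^{2b}$, and every $\varepsilon>0$. Let $\mathcal P$ be a nonempty, monotone-increasing, row-symmetric, $b$-local and scalar-invariant property of linear codes in $\mathbb F_q^n$. Let $m\ge1$, let $\mathcal D\subseteq\mathbb F_q^m$ be a linear code of $q^{-b}$-optimal distance, and let $\mathcal C$ be a random $n$-puncturing of $\mathcal D$ of design rate $R\le\mathrm{RLC}(\mathcal P)-\varepsilon-2\log_q2$. Then $$\Pr[\mathcal C\text{ satisfies }\mathcal P]\le q^{-(\varepsilon-\delta(n))n}.$$ -/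

import Mathlib

open Filter Topology

noncomputable section

namespace LocalCodes

/-- The probability that a sample of the distribution `μ` lies in `S`. -/
def prob {α : Type*} (μ : PMF α) (S : Set α) : ℝ := (μ.toOuterMeasure S).toReal

/-- A linear code of length `n` over the field `F`. -/
abbrev LinearCode (F : Type*) [Field F] (n : ℕ) : Type _ := Submodule F (Fin n → F)

/-- A property of length-`n` linear codes over `F` is a collection of such codes. -/
abbrev CodeProperty (F : Type*) [Field F] (n : ℕ) : Type _ := Set (LinearCode F n)

section Properties

variable {F : Type*} [Field F] {n : ℕ}

/-- Upward closed with respect to containment of linear codes. -/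
def MonotoneIncreasing (P : CodeProperty F n) : Prop :=
  ∀ ⦃C C' : LinearCode F n⦄, C ≤ C' → C ∈ P → C' ∈ P

/-- Closed under permuting the coordinates of a code. -/
def RowSymmetric (P : CodeProperty F n) : Prop :=
  ∀ C ∈ P, ∀ π : Equiv.Perm (Fin n), C.map (LinearMap.funLeft F F π) ∈ P

/-- `C` satisfies `P` iff `C` contains a member of a fixed family of sets of at most `b` words. -/
def IsLocal (b : ℕ) (P : CodeProperty F n) : Prop :=
  ∃ 𝓑 : Set (Set (Fin n → F)), (∀ B ∈ 𝓑, B.encard ≤ (b : ℕ∞)) ∧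
    ∀ C : LinearCode F n, C ∈ P ↔ ∃ B ∈ 𝓑, B ⊆ (C : Set (Fin n → F))

/-- Closed under multiplication of a code by diagonal matrices of full rank. -/
def ScalarInvariant (P : CodeProperty F n) : Prop :=
  ∀ C ∈ P, ∀ Λ : Matrix (Fin n) (Fin n) F, Λ.IsDiag → Λ.rank = n → C.map Λ.mulVecLin ∈ P

end Properties

section Random

variable {F : Type*} [Field F] [Fintype F]

open Classical in
/-- The row span of a uniformly random `k × n` matrix: a random linear code of rate `k / n`. -/
def randomLinearCode (F : Type*) [Field F] [Fintype F] (k n : ℕ) : PMF (LinearCode F n) :=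
  (PMF.uniformOfFintype (Matrix (Fin k) (Fin n) F)).map
    fun A => Submodule.span F (Set.range A.row)

/-- The threshold `RLC(P)`: the least rate `R ∈ [0, 1]` (with `R n` an integer) at which a random
linear code of rate `R` satisfies `P` with probability at least `1 / 2`. -/
def rlcThreshold {n : ℕ} (P : CodeProperty F n) : ℝ :=
  sInf {R : ℝ | 0 ≤ R ∧ R ≤ 1 ∧
    ∃ k : ℕ, (k : ℝ) = R * n ∧ 1 / 2 ≤ prob (randomLinearCode F k n) P}

open Classical in
/-- The normalized Hamming weight. -/
def normalizedWeight {m : ℕ} (u : Fin m → F) : ℝ := (hammingNorm u : ℝ) / m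

/-- Every nonzero codeword has normalized weight at least `(q - 1) (1 - η) / q`. -/
def HasOptimalDistance {m : ℕ} (η : ℝ) (D : LinearCode F m) : Prop :=
  ∀ u ∈ D, u ≠ 0 →
    ((Fintype.card F : ℝ) - 1) * (1 - η) / (Fintype.card F : ℝ) ≤ normalizedWeight u

/-- The random `n`-puncturing of `D`: the image of `D` under `u ↦ (u_{i 1}, …, u_{i n})`, where
the `i j` are independent and uniform, that is, where `i : Fin n → Fin m` is uniform. -/
def randomPuncturing {m : ℕ} [NeZero m] (D : LinearCode F m) (n : ℕ) : PMF (LinearCode F n) :=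
  (PMF.uniformOfFintype (Fin n → Fin m)).map fun i => D.map (LinearMap.funLeft F F i)

/-- The design rate `log_q |D| / n` of a random `n`-puncturing of `D`. -/
def designRate {m : ℕ} (D : LinearCode F m) (n : ℕ) : ℝ :=
  Real.logb (Fintype.card F) (Nat.card D) / n

end Random

end LocalCodes

end

/-! A code with a `b`-local property contains the span `W` of a witnessing set, and `dim W ≤ b`. By
row symmetry any coordinate permutation of `W` serves as well. A basis of a `d`-dimensional `U ≤ W`
has `n! / fixCard U` permuted images, each contained in a random code of dimension `k` with
probability about `q ^ (-(n - k) d)`. If the expected number of images is large for every nonzero `U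
≤ W`, the second moment method (`half_le_card_contains_perm`) puts a copy of `W` in the random code
with probability at least `1/2`. Hence, below the threshold, every code in `P` contains an
independent `d`-tuple whose orbit has size at most `q ^ ((n - k) d)` up to lower order factors
(`exists_tuple_large_fixCard`). A `d`-tuple of words is one word over an alphabet of size `q ^ d`,
so there are at most `(n + 1) ^ (q ^ d)` orbits, and such tuples are few (`card_large_fixCard_le`).

It remains to take a union bound over these tuples for the punctured code
(`prob_randomPuncturing_le`). By scalar invariance the puncturing may be followed by a random
diagonal scaling. Near-optimal distance then bounds the probability of each value of a coordinate of
`d` independent codewords by `4 / q ^ d` (`card_scaled_coordinate_le`), so a given tuple appears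
with probability at most `|D| ^ d (4 / q ^ d) ^ n`. The loss `4 ^ n` is what `2 log_q 2` in the rate
pays for; the hypothesis on `n / log n` makes everything else `q ^ o(n)`. -/

namespace LocalCodes

open Module

/-! ### Counting linear maps and subspaces; the second moment inequality. -/

section Counting

variable {F : Type*} [Field F] [Fintype F]

instance finite_linearMap {V M : Type*} [AddCommGroup V] [Module F V] [Finite V]
    [AddCommGroup M] [Module F M] [Finite M] : Finite (V →ₗ[F] M) :=
  Finite.of_injective (fun f : V →ₗ[F] M => (f : V → M)) DFunLike.coe_injective

variable {A V M : Type*} [AddCommGroup A] [Module F A] [Finite A]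
  [AddCommGroup V] [Module F V] [Finite V] [AddCommGroup M] [Module F M] [Finite M]

lemma card_linearMap :
    Nat.card (V →ₗ[F] M) = Fintype.card F ^ (finrank F V * finrank F M) := by
  rw [Module.natCard_eq_pow_finrank (K := F), Module.finrank_linearMap, Nat.card_eq_fintype_card]

/-- Precomposition with `x` is surjective because `x` has a left inverse, and the fibres of a
surjective linear map are translates of one another. -/
lemma card_extensions (x : A →ₗ[F] V) (hx : Function.Injective x) (f : A →ₗ[F] M) :
    Nat.card {G : V →ₗ[F] M // G ∘ₗ x = f} * Fintype.card F ^ (finrank F A * finrank F M)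
      = Fintype.card F ^ (finrank F V * finrank F M) := by
  classical
  have := Fintype.ofFinite (V →ₗ[F] M)
  have := Fintype.ofFinite (A →ₗ[F] M)
  let φ : (V →ₗ[F] M) →ₗ[F] (A →ₗ[F] M) := LinearMap.lcomp F M x
  obtain ⟨y, hy⟩ := LinearMap.exists_leftInverse_of_injective x (LinearMap.ker_eq_bot.2 hx)
  have hsurj : ∀ g : A →ₗ[F] M, ∃ G : V →ₗ[F] M, G ∘ₗ x = g := fun g =>
    ⟨g ∘ₗ y, by rw [LinearMap.comp_assoc, hy, LinearMap.comp_id]⟩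
  have hfib : ∀ g : A →ₗ[F] M,
      (Finset.univ.filter fun G : V →ₗ[F] M => G ∘ₗ x = g).card
        = (Finset.univ.filter fun G : V →ₗ[F] M => G ∘ₗ x = f).card := by
    intro g
    obtain ⟨G₁, h₁⟩ := hsurj g
    obtain ⟨G₂, h₂⟩ := hsurj f
    refine Finset.card_bij' (fun G _ => G - G₁ + G₂) (fun G _ => G - G₂ + G₁) ?_ ?_ ?_ ?_
    · intro G hG
      simp only [Finset.mem_filter, Finset.mem_univ, true_and] at hG ⊢
      rw [LinearMap.add_comp, LinearMap.sub_comp, hG, h₁, h₂]; simp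
    · intro G hG
      simp only [Finset.mem_filter, Finset.mem_univ, true_and] at hG ⊢
      rw [LinearMap.add_comp, LinearMap.sub_comp, hG, h₁, h₂]; simp
    · intro G _; simp
    · intro G _; simp
  have htot := Finset.card_eq_sum_card_fiberwise (s := (Finset.univ : Finset (V →ₗ[F] M)))
    (t := (Finset.univ : Finset (A →ₗ[F] M))) (f := fun G => G ∘ₗ x) (fun _ _ => by simp)
  rw [Finset.sum_congr rfl (fun g _ => hfib g), Finset.sum_const, Finset.card_univ,
    Finset.card_univ, smul_eq_mul] at htot
  rw [← card_linearMap (F := F) (V := V) (M := M), ← card_linearMap (F := F) (V := A) (M := M),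
    Nat.card_eq_fintype_card, Nat.card_eq_fintype_card, Nat.card_eq_fintype_card, htot,
    Fintype.card_subtype, mul_comm]

/-- Any two solutions `G` agree on the sum of the two ranges, so all of them extend a single map
defined there. -/
lemma card_common_extensions_le (x y : A →ₗ[F] V) (f g : A →ₗ[F] M) :
    Nat.card {G : V →ₗ[F] M // G ∘ₗ x = f ∧ G ∘ₗ y = g}
      * Fintype.card F ^
        (finrank F (LinearMap.range x ⊔ LinearMap.range y : Submodule F V) * finrank F M)
      ≤ Fintype.card F ^ (finrank F V * finrank F M) := by
  rcases isEmpty_or_nonempty {G : V →ₗ[F] M // G ∘ₗ x = f ∧ G ∘ₗ y = g} with h | ⟨⟨G₀, h₀⟩⟩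
  · simp
  let S : Submodule F V := LinearMap.range x ⊔ LinearMap.range y
  rw [← card_extensions S.subtype S.injective_subtype (G₀ ∘ₗ S.subtype)]
  refine Nat.mul_le_mul_right _ ?_
  refine Nat.card_le_card_of_injective
    (fun G => ⟨G.1, ?_⟩) (fun G G' h => Subtype.ext (Subtype.mk.inj h))
  have hle : S ≤ LinearMap.eqLocus G.1 G₀ := by
    refine sup_le ?_ ?_
    · rintro _ ⟨a, rfl⟩
      exact LinearMap.congr_fun (G.2.1.trans h₀.1.symm) a
    · rintro _ ⟨a, rfl⟩
      exact LinearMap.congr_fun (G.2.2.trans h₀.2.symm) a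
  ext u
  exact hle u.2

/-- Linear maps sending a subspace `U` into a subspace `T`. -/
lemma card_mapsTo_mul (U : Submodule F A) (T : Submodule F V) :
    Nat.card {y : A →ₗ[F] V // U ≤ T.comap y} * Fintype.card F ^ (finrank F U * finrank F V)
      ≤ Fintype.card F ^ (finrank F U * finrank F T) *
        Fintype.card F ^ (finrank F A * finrank F V) := by
  classical
  have := Fintype.ofFinite (A →ₗ[F] V)
  have := Fintype.ofFinite (U →ₗ[F] T)
  have hcover : (Finset.univ.filter fun y : A →ₗ[F] V => U ≤ T.comap y) ⊆
      (Finset.univ : Finset (U →ₗ[F] T)).biUnion fun h =>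
        Finset.univ.filter fun y : A →ₗ[F] V => y ∘ₗ U.subtype = T.subtype ∘ₗ h := by
    intro y hy
    simp only [Finset.mem_filter, Finset.mem_univ, true_and, Finset.mem_biUnion] at hy ⊢
    refine ⟨(y ∘ₗ U.subtype).codRestrict T fun u => hy u.2, ?_⟩
    ext u; rfl
  have hcard := (Finset.card_le_card hcover).trans Finset.card_biUnion_le
  rw [Nat.card_eq_fintype_card, Fintype.card_subtype,
    ← card_linearMap (F := F) (V := U) (M := T)]
  refine (Nat.mul_le_mul_right _ hcard).trans ?_
  rw [Finset.sum_mul, Nat.card_eq_fintype_card, ← Finset.card_univ (α := U →ₗ[F] T),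
    ← smul_eq_mul (a := Finset.card _), ← Finset.sum_const]
  refine Finset.sum_le_sum fun h _ => ?_
  have := card_extensions U.subtype U.injective_subtype (T.subtype ∘ₗ h)
  rw [← this, Nat.card_eq_fintype_card, Fintype.card_subtype]

/-- Most linear maps into a space of larger dimension are injective. -/
lemma card_not_injective_mul_le (hAV : finrank F A + 2 ≤ finrank F V) :
    Nat.card {x : A →ₗ[F] V // ¬ Function.Injective x} * 4
      ≤ Fintype.card F ^ (finrank F A * finrank F V) := by
  classical
  have := Fintype.ofFinite A
  have := Fintype.ofFinite (A →ₗ[F] V)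
  have hq : 2 ≤ Fintype.card F := Fintype.one_lt_card
  -- Union bound over the nonzero kernel vectors: the proportion of bad maps is at most `q ^ (dim A
  -- - dim V) ≤ q ^ (-2) ≤ 1/4`.
  have hcover : (Finset.univ.filter fun x : A →ₗ[F] V => ¬ Function.Injective x) ⊆
      ((Finset.univ : Finset A).filter (· ≠ 0)).biUnion fun a =>
        Finset.univ.filter fun x : A →ₗ[F] V => x a = 0 := by
    intro x hx
    simp only [Finset.mem_filter, Finset.mem_univ, true_and, Finset.mem_biUnion,
      injective_iff_map_eq_zero] at hx ⊢
    push Not at hx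
    obtain ⟨a, h, h0⟩ := hx
    exact ⟨a, h0, h⟩
  have hfib : ∀ a : A, a ≠ 0 →
      (Finset.univ.filter fun x : A →ₗ[F] V => x a = 0).card * Fintype.card F ^ finrank F V
        = Fintype.card F ^ (finrank F A * finrank F V) := by
    intro a ha
    have h := card_extensions (M := V) (LinearMap.toSpanSingleton F A a)
      (by
        intro r r' h
        simpa [sub_eq_zero, ha, ← sub_smul] using sub_eq_zero.2 h) 0
    rw [finrank_self, one_mul] at h
    rw [← h, Nat.card_eq_fintype_card, Fintype.card_subtype]
    congr 2
    ext x
    simp [LinearMap.ext_ring_iff]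
  have hcard := (Finset.card_le_card hcover).trans Finset.card_biUnion_le
  have hA : ((Finset.univ : Finset A).filter (· ≠ 0)).card ≤ Fintype.card F ^ finrank F A := by
    refine (Finset.card_le_univ _).trans ?_
    rw [← Nat.card_eq_fintype_card, Module.natCard_eq_pow_finrank (K := F),
      Nat.card_eq_fintype_card]
  rw [Nat.card_eq_fintype_card, Fintype.card_subtype]
  have hpos : 0 < Fintype.card F ^ finrank F V := by positivity
  refine Nat.le_of_mul_le_mul_right ?_ hpos
  calc _ ≤ (∑ a ∈ (Finset.univ : Finset A).filter (· ≠ 0),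
        (Finset.univ.filter fun x : A →ₗ[F] V => x a = 0).card) * 4 *
          Fintype.card F ^ finrank F V := by gcongr
    _ = 4 * ∑ a ∈ (Finset.univ : Finset A).filter (· ≠ 0),
        (Finset.univ.filter fun x : A →ₗ[F] V => x a = 0).card *
          Fintype.card F ^ finrank F V := by rw [← Finset.sum_mul]; ring
    _ = 4 * (((Finset.univ : Finset A).filter (· ≠ 0)).card *
          Fintype.card F ^ (finrank F A * finrank F V)) := by
        rw [Finset.sum_congr rfl fun a ha => hfib a (Finset.mem_filter.1 ha).2,
          Finset.sum_const, smul_eq_mul]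
    _ ≤ Fintype.card F ^ 2 * (Fintype.card F ^ finrank F A *
          Fintype.card F ^ (finrank F A * finrank F V)) := by
        gcongr
        nlinarith
    _ = Fintype.card F ^ (finrank F A * finrank F V) * Fintype.card F ^ (finrank F A + 2) := by
        ring
    _ ≤ _ := by
        gcongr
        omega

/-- Every subspace is the range of an endomorphism, namely of a projection onto it. -/
lemma card_submodule_le : Nat.card (Submodule F A) ≤ Fintype.card F ^ (finrank F A * finrank F A) := by
  rw [← card_linearMap]
  refine Nat.card_le_card_of_surjective (fun f : A →ₗ[F] A => LinearMap.range f) fun U => ?_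
  obtain ⟨f, hf⟩ := LinearMap.exists_leftInverse_of_injective U.subtype
    (LinearMap.ker_eq_bot.2 U.injective_subtype)
  refine ⟨U.subtype ∘ₗ f, ?_⟩
  have : Function.Surjective f := fun u => ⟨u, LinearMap.congr_fun hf u⟩
  change LinearMap.range (U.subtype ∘ₗ f) = U
  rw [LinearMap.range_comp, LinearMap.range_eq_top.2 this, Submodule.map_top,
    Submodule.range_subtype]

/-- The second moment method for a relation between two finite types. -/
lemma sq_sum_card_le {Γ I : Type*} [Fintype Γ] [Fintype I] (R : Γ → I → Prop)
    [∀ G i, Decidable (R G i)] [DecidablePred fun G => ∃ i, R G i] :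
    (∑ i, (Finset.univ.filter fun G => R G i).card) ^ 2
      ≤ (Finset.univ.filter fun G => ∃ i, R G i).card *
        ∑ i, ∑ j, (Finset.univ.filter fun G => R G i ∧ R G j).card := by
  classical
  have h1 : ∑ i, (Finset.univ.filter fun G => R G i).card
      = ∑ G ∈ Finset.univ.filter (fun G => ∃ i, R G i),
        (Finset.univ.filter fun i => R G i).card := by
    refine (Finset.sum_card_bipartiteAbove_eq_sum_card_bipartiteBelow R
      (s := Finset.univ) (t := Finset.univ)).symm.trans ?_
    symm
    refine Finset.sum_subset (Finset.filter_subset _ _) fun G _ hG => ?_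
    simp only [Finset.mem_filter, Finset.mem_univ, true_and, not_exists] at hG
    simp [hG]
  rw [h1]
  -- Cauchy–Schwarz over those `G` that are related to at least one index.
  refine sq_sum_le_card_mul_sum_sq.trans (Nat.mul_le_mul_left _ ?_)
  refine (Finset.sum_le_sum_of_subset (Finset.filter_subset _ _)).trans (le_of_eq ?_)
  simp_rw [sq, Finset.card_filter, Finset.sum_mul_sum]
  rw [Finset.sum_comm]
  refine Finset.sum_congr rfl fun i _ => ?_
  rw [Finset.sum_comm]
  refine Finset.sum_congr rfl fun j _ => Finset.sum_congr rfl fun G _ => ?_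
  by_cases h : R G i <;> by_cases h' : R G j <;> simp [h, h']

end Counting

/-! ### Random linear codes containing a permuted copy of a given code. -/

/-- The number of coordinate permutations fixing every word of `U`. -/
noncomputable def fixCard {X : Type*} {n : ℕ} (U : Set (Fin n → X)) : ℕ :=
  Nat.card {π : Equiv.Perm (Fin n) // ∀ u ∈ U, u ∘ π = u}

section SecondMoment

variable {F : Type*} [Field F] [Fintype F] {n k : ℕ}

noncomputable instance fintype_linearMap {V M : Type*} [AddCommGroup V] [Module F V] [Finite V]
    [AddCommGroup M] [Module F M] [Finite M] : Fintype (V →ₗ[F] M) :=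
  Fintype.ofFinite _

/-- The inclusion of a code, followed by a permutation of the coordinates. -/
def permIncl (W : LinearCode F n) (π : Equiv.Perm (Fin n)) : W →ₗ[F] (Fin n → F) :=
  LinearMap.funLeft F F π ∘ₗ W.subtype

lemma finrank_comap_range {A V : Type*} [AddCommGroup A] [Module F A] [Finite A]
    [AddCommGroup V] [Module F V] [Finite V] (x y : A →ₗ[F] V) (hx : Function.Injective x)
    (hy : Function.Injective y) :
    finrank F (LinearMap.range x ⊔ LinearMap.range y : Submodule F V)
      + finrank F ((LinearMap.range x).comap y) = 2 * finrank F A := by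
  have h1 : finrank F ((LinearMap.range x).comap y)
      = finrank F (LinearMap.range x ⊓ LinearMap.range y : Submodule F V) := by
    rw [inf_comm, ← Submodule.map_comap_eq]
    exact (Submodule.equivMapOfInjective y hy _).finrank_eq
  rw [h1, Submodule.finrank_sup_add_finrank_inf_eq, LinearMap.finrank_range_of_inj hx,
    LinearMap.finrank_range_of_inj hy, two_mul]

-- On `U`, where `y` takes values in the range of `x`, a common extension is already determined by
-- `x` and `π`. This prescribes `u ∘ π'` for every `u` in `U`, so the feasible `π'` lie in a single
-- coset of the group fixing `U`. For each of them the number of extensions depends only on `dim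
-- (range x + range y) = 2 dim W - dim U`.
open Classical in
lemma sum_card_pair_le (W : LinearCode F n) (x y : W →ₗ[F] (Fin k → F))
    (hx : Function.Injective x) (hy : Function.Injective y) (π : Equiv.Perm (Fin n)) :
    (∑ π' : Equiv.Perm (Fin n), Nat.card {G : (Fin k → F) →ₗ[F] (Fin n → F) //
        G ∘ₗ x = permIncl W π ∧ G ∘ₗ y = permIncl W π'}) *
      Fintype.card F ^ (2 * finrank F W * n)
      ≤ fixCard (((LinearMap.range x).comap y).map W.subtype : Set (Fin n → F)) *
        (Fintype.card F ^ (k * n) *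
          Fintype.card F ^ (finrank F ((LinearMap.range x).comap y) * n)) := by
  set U := (LinearMap.range x).comap y with hU
  let S : Finset (Equiv.Perm (Fin n)) := Finset.univ.filter fun π' =>
    ∃ G : (Fin k → F) →ₗ[F] (Fin n → F), G ∘ₗ x = permIncl W π ∧ G ∘ₗ y = permIncl W π'
  have hterm : ∀ π', Nat.card {G : (Fin k → F) →ₗ[F] (Fin n → F) //
        G ∘ₗ x = permIncl W π ∧ G ∘ₗ y = permIncl W π'} *
      Fintype.card F ^ (2 * finrank F W * n) ≤
      Fintype.card F ^ (k * n) * Fintype.card F ^ (finrank F U * n) := by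
    intro π'
    have h := card_common_extensions_le x y (permIncl W π) (permIncl W π')
    rw [finrank_fin_fun, finrank_fin_fun] at h
    rw [← finrank_comap_range x y hx hy, add_mul, pow_add, ← mul_assoc]
    exact Nat.mul_le_mul_right _ h
  have hS : S.card ≤ fixCard ((U.map W.subtype : Submodule F (Fin n → F)) : Set (Fin n → F)) := by
    rcases S.eq_empty_or_nonempty with h | ⟨π₀, h₀⟩
    · simp [h]
    have key : ∀ π' ∈ S, ∀ u ∈ U.map W.subtype, u ∘ π' = u ∘ π₀ := by
      rintro π' hπ' _ ⟨u, hu, rfl⟩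
      obtain ⟨G, hG, hG'⟩ := (Finset.mem_filter.1 hπ').2
      obtain ⟨G₀, hG₀, hG₀'⟩ := (Finset.mem_filter.1 h₀).2
      obtain ⟨a, ha⟩ : ∃ a, x a = y u := hu
      have e1 : permIncl W π' u = permIncl W π a := by
        rw [← hG', ← hG]; simp [ha]
      have e2 : permIncl W π₀ u = permIncl W π a := by
        rw [← hG₀', ← hG₀]; simp [ha]
      exact e1.trans e2.symm
    rw [← Nat.card_eq_finsetCard]
    refine Nat.card_le_card_of_injective
      (fun π' => ⟨π'.1 * π₀⁻¹, fun u hu => ?_⟩) fun π' π'' h => ?_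
    · have := congrArg (· ∘ (π₀⁻¹ : Equiv.Perm (Fin n))) (key π'.1 π'.2 u hu)
      funext j
      simpa using congrFun this j
    · exact Subtype.ext (mul_right_cancel (Subtype.mk.inj h))
  have hsupp : (∑ π' : Equiv.Perm (Fin n), Nat.card {G : (Fin k → F) →ₗ[F] (Fin n → F) //
        G ∘ₗ x = permIncl W π ∧ G ∘ₗ y = permIncl W π'}) =
      ∑ π' ∈ S, Nat.card {G : (Fin k → F) →ₗ[F] (Fin n → F) //
        G ∘ₗ x = permIncl W π ∧ G ∘ₗ y = permIncl W π'} := by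
    symm
    refine Finset.sum_subset (Finset.subset_univ _) fun π' _ hπ' => ?_
    have : IsEmpty {G : (Fin k → F) →ₗ[F] (Fin n → F) //
        G ∘ₗ x = permIncl W π ∧ G ∘ₗ y = permIncl W π'} :=
      ⟨fun G => hπ' (Finset.mem_filter.2 ⟨Finset.mem_univ _, G.1, G.2⟩)⟩
    exact Nat.card_of_isEmpty
  rw [hsupp, Finset.sum_mul]
  refine (Finset.sum_le_card_nsmul _ _ _ fun π' _ => hterm π').trans ?_
  rw [smul_eq_mul]
  exact Nat.mul_le_mul_right _ hS

-- The maps `y` are sorted by `U = y⁻¹(range x)`. The case `U = ⊥` is the uncorrelated one and gives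
-- the main term. The hypothesis `hW` is exactly what bounds the share of each other `U` by `1 / (4
-- N)` of the main term, `N` being the number of subspaces of `W`; the total is therefore at most
-- `5/4` of it.
open Classical in
lemma second_moment_le (W : LinearCode F n)
    (hW : ∀ U : Submodule F W, U ≠ ⊥ →
      4 * Nat.card (Submodule F W) * Fintype.card F ^ (finrank F W * finrank F U) *
        Fintype.card F ^ (n * finrank F U) * fixCard (U.map W.subtype : Set (Fin n → F))
        ≤ n.factorial * Fintype.card F ^ (k * finrank F U))
    (x : W →ₗ[F] (Fin k → F)) (hx : Function.Injective x) (π : Equiv.Perm (Fin n)) :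
    (∑ y : {y : W →ₗ[F] (Fin k → F) // Function.Injective y}, ∑ π' : Equiv.Perm (Fin n),
      (Nat.card {G : (Fin k → F) →ₗ[F] (Fin n → F) //
        G ∘ₗ x = permIncl W π ∧ G ∘ₗ y.1 = permIncl W π'} : ℝ)) *
      (Fintype.card F : ℝ) ^ (2 * finrank F W * n)
      ≤ 5 / 4 * n.factorial * (Fintype.card F : ℝ) ^ (finrank F W * k) *
        (Fintype.card F : ℝ) ^ (k * n) := by
  set q : ℝ := (Fintype.card F : ℝ) with hq
  have hq0 : 0 < q := by
    have : 0 < Fintype.card F := Fintype.card_pos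
    rw [hq]; exact_mod_cast this
  set s := finrank F W with hs
  have := Fintype.ofFinite (Submodule F W)
  let f : Submodule F W → ℝ := fun U =>
    (fixCard (U.map W.subtype : Set (Fin n → F)) : ℝ) * (q ^ (k * n) * q ^ (finrank F U * n))
  have hf0 : ∀ U, 0 ≤ f U := fun U => by positivity
  have h1 : ∀ y : {y : W →ₗ[F] (Fin k → F) // Function.Injective y},
      (∑ π' : Equiv.Perm (Fin n), (Nat.card {G : (Fin k → F) →ₗ[F] (Fin n → F) //
        G ∘ₗ x = permIncl W π ∧ G ∘ₗ y.1 = permIncl W π'} : ℝ)) * q ^ (2 * s * n)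
      ≤ f ((LinearMap.range x).comap y.1) := fun y => by
    simp only [f]
    rw [hq, hs]
    exact_mod_cast sum_card_pair_le W x y.1 hx y.2 π
  rw [Finset.sum_mul]
  refine (Finset.sum_le_sum fun y _ => h1 y).trans ?_
  have h2 : ∑ y : {y : W →ₗ[F] (Fin k → F) // Function.Injective y},
      f ((LinearMap.range x).comap y.1) ≤
      ∑ U : Submodule F W,
        (Nat.card {y : W →ₗ[F] (Fin k → F) // U ≤ (LinearMap.range x).comap y} : ℝ) * f U := by
    rw [← Finset.sum_fiberwise (s := Finset.univ)
      (g := fun y : {y : W →ₗ[F] (Fin k → F) // Function.Injective y} =>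
        (LinearMap.range x).comap y.1)]
    refine Finset.sum_le_sum fun U _ => ?_
    rw [Finset.sum_congr rfl (g := fun _ => f U)
      (fun y hy => by rw [(Finset.mem_filter.1 hy).2]), Finset.sum_const, nsmul_eq_mul]
    refine mul_le_mul_of_nonneg_right ?_ (hf0 U)
    rw [← Nat.card_eq_finsetCard, Nat.cast_le]
    refine Nat.card_le_card_of_injective (fun y => ⟨y.1.1, ?_⟩) fun y y' h => ?_
    · exact (Finset.mem_filter.1 y.2).2.ge
    · exact Subtype.ext (Subtype.ext (Subtype.mk.inj h))
  refine h2.trans ?_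
  set B : ℝ := n.factorial * q ^ (s * k) * q ^ (k * n) with hB
  have hB0 : 0 ≤ B := by positivity
  have hN : (0 : ℝ) < Nat.card (Submodule F W) := by exact_mod_cast Nat.card_pos
  have h3 : ∀ U : Submodule F W,
      (Nat.card {y : W →ₗ[F] (Fin k → F) // U ≤ (LinearMap.range x).comap y} : ℝ) * f U
        ≤ B / (4 * Nat.card (Submodule F W)) + if U = ⊥ then B else 0 := by
    intro U
    have hc : (Nat.card {y : W →ₗ[F] (Fin k → F) // U ≤ (LinearMap.range x).comap y} : ℝ) *
        q ^ (finrank F U * k) ≤ q ^ (finrank F U * s) * q ^ (s * k) := by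
      have h := card_mapsTo_mul U (LinearMap.range x)
      rw [finrank_fin_fun, LinearMap.finrank_range_of_inj hx] at h
      rw [hq, hs]
      exact_mod_cast h
    by_cases hU : U = ⊥
    · subst hU
      have hfix : fixCard ((⊥ : Submodule F W).map W.subtype : Set (Fin n → F))
          = n.factorial := by
        have : ∀ π : Equiv.Perm (Fin n), ∀ u ∈ ((⊥ : Submodule F W).map W.subtype :
            Set (Fin n → F)), u ∘ π = u := by
          intro π u hu
          simp at hu
          subst hu
          rfl
        rw [fixCard, Nat.card_congr (Equiv.subtypeUnivEquiv this), Nat.card_perm, Nat.card_fin]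
      simp only [finrank_bot, zero_mul, pow_zero, mul_one, one_mul, if_true, f, hfix] at hc ⊢
      have : 0 ≤ B / (4 * Nat.card (Submodule F W)) := by positivity
      have := mul_le_mul_of_nonneg_right hc
        (by positivity : 0 ≤ (n.factorial : ℝ) * q ^ (k * n))
      rw [hB] at *
      linarith
    · rw [if_neg hU, add_zero, le_div_iff₀ (by positivity)]
      have h4 : 4 * (Nat.card (Submodule F W) : ℝ) * q ^ (s * finrank F U) *
          q ^ (n * finrank F U) * (fixCard (U.map W.subtype : Set (Fin n → F)) : ℝ)
          ≤ n.factorial * q ^ (k * finrank F U) := by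
        rw [hq]; exact_mod_cast hW U hU
      have hp : 0 < q ^ (k * finrank F U) := by positivity
      refine le_of_mul_le_mul_right ?_ hp
      set c := (Nat.card {y : W →ₗ[F] (Fin k → F) // U ≤ (LinearMap.range x).comap y} : ℝ)
      set φ := (fixCard (U.map W.subtype : Set (Fin n → F)) : ℝ) with hφ
      set Nn := (Nat.card (Submodule F W) : ℝ)
      set d := finrank F U
      have e : f U = φ * (q ^ (k * n) * q ^ (d * n)) := rfl
      rw [e]
      calc c * (φ * (q ^ (k * n) * q ^ (d * n))) * (4 * Nn) * q ^ (k * d)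
          = (c * q ^ (d * k)) * (φ * (q ^ (k * n) * q ^ (d * n)) * (4 * Nn)) := by
            rw [mul_comm k d]; ring
        _ ≤ (q ^ (d * s) * q ^ (s * k)) * (φ * (q ^ (k * n) * q ^ (d * n)) * (4 * Nn)) := by
            refine mul_le_mul_of_nonneg_right hc (by positivity)
        _ = (4 * Nn * q ^ (s * d) * q ^ (n * d) * φ) * (q ^ (s * k) * q ^ (k * n)) := by
            rw [mul_comm d s, mul_comm d n]; ring
        _ ≤ (n.factorial * q ^ (k * d)) * (q ^ (s * k) * q ^ (k * n)) := by
            refine mul_le_mul_of_nonneg_right h4 (by positivity)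
        _ = B * q ^ (k * d) := by rw [hB]; ring
  refine (Finset.sum_le_sum fun U _ => h3 U).trans (le_of_eq ?_)
  rw [Finset.sum_add_distrib, Finset.sum_const, Finset.card_univ, ← Nat.card_eq_fintype_card,
    nsmul_eq_mul, Finset.sum_ite_eq' Finset.univ ⊥ (fun _ => B), if_pos (Finset.mem_univ _), hB]
  field_simp
  ring

open Classical in
/-- If no nonzero subspace of `W` has too few images under coordinate permutations, then most
random codes of dimension `k` contain an image of `W`. -/
theorem half_le_card_contains_perm (W : LinearCode F n) (hk : finrank F W + 2 ≤ k)
    (hW : ∀ U : Submodule F W, U ≠ ⊥ →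
      4 * Nat.card (Submodule F W) * Fintype.card F ^ (finrank F W * finrank F U) *
        Fintype.card F ^ (n * finrank F U) * fixCard (U.map W.subtype : Set (Fin n → F))
        ≤ n.factorial * Fintype.card F ^ (k * finrank F U)) :
    Fintype.card F ^ (k * n) ≤ 2 *
      Nat.card {G : (Fin k → F) →ₗ[F] (Fin n → F) //
        ∃ π : Equiv.Perm (Fin n), W.map (LinearMap.funLeft F F π) ≤ LinearMap.range G} := by
  set q : ℝ := (Fintype.card F : ℝ) with hq
  have hq0 : 0 < q := by
    have : 0 < Fintype.card F := Fintype.card_pos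
    rw [hq]; exact_mod_cast this
  set s := finrank F W with hs
  -- A pair `(x, π)` is a placement of `W`: if `G ∘ x` is the inclusion permuted by `π`, then the
  -- range of `G` contains that permuted copy. The placements satisfied by a random `G` are counted.
  let I := {x : W →ₗ[F] (Fin k → F) // Function.Injective x} × Equiv.Perm (Fin n)
  let R : ((Fin k → F) →ₗ[F] (Fin n → F)) → I → Prop := fun G i =>
    G ∘ₗ i.1.1 = permIncl W i.2
  set inj : ℝ := (Fintype.card {x : W →ₗ[F] (Fin k → F) // Function.Injective x} : ℝ) with hinj
  have hinj1 : 3 / 4 * q ^ (s * k) ≤ inj := by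
    have h1 := card_not_injective_mul_le (F := F) (A := W) (V := Fin k → F)
      (by rwa [finrank_fin_fun])
    have h2 := Fintype.card_subtype_compl (fun x : W →ₗ[F] (Fin k → F) => Function.Injective x)
    have h3 := Fintype.card_subtype_le (fun x : W →ₗ[F] (Fin k → F) => Function.Injective x)
    have h4 := card_linearMap (F := F) (V := W) (M := Fin k → F)
    rw [Nat.card_eq_fintype_card] at h1 h4
    rw [← hs] at h1 h4
    rw [finrank_fin_fun] at h1 h4
    have h5 : Fintype.card {x : W →ₗ[F] (Fin k → F) // ¬ Function.Injective x} +
      Fintype.card {x : W →ₗ[F] (Fin k → F) // Function.Injective x}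
      = Fintype.card F ^ (s * k) := by omega
    have h5' : (Fintype.card {x : W →ₗ[F] (Fin k → F) // ¬ Function.Injective x} : ℝ) + inj
      = q ^ (s * k) := by rw [hinj, hq]; exact_mod_cast h5
    have h1' : (Fintype.card {x : W →ₗ[F] (Fin k → F) // ¬ Function.Injective x} : ℝ) * 4
      ≤ q ^ (s * k) := by rw [hq]; exact_mod_cast h1
    linarith
  have hinj0 : 0 < inj := lt_of_lt_of_le (by positivity) hinj1
  have hfirst : ((∑ i, (Finset.univ.filter fun G => R G i).card : ℕ) : ℝ) * q ^ (s * n)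
      = inj * n.factorial * q ^ (k * n) := by
    have h : ∀ i, ((Finset.univ.filter fun G => R G i).card : ℝ) * q ^ (s * n) = q ^ (k * n) := by
      intro i
      have h := card_extensions i.1.1 i.1.2 (permIncl W i.2)
      rw [finrank_fin_fun, finrank_fin_fun, Nat.card_eq_fintype_card, Fintype.card_subtype] at h
      rw [hq, hs]
      exact_mod_cast h
    push_cast
    rw [Finset.sum_mul, Finset.sum_congr rfl fun i _ => h i, Finset.sum_const, Finset.card_univ,
      Fintype.card_prod, Fintype.card_perm, Fintype.card_fin, nsmul_eq_mul]
    push_cast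
    rfl
  have hsecond : ((∑ i, ∑ j, (Finset.univ.filter fun G => R G i ∧ R G j).card : ℕ) : ℝ) *
      q ^ (2 * s * n) ≤ inj * n.factorial *
        (5 / 4 * n.factorial * q ^ (s * k) * q ^ (k * n)) := by
    push_cast
    rw [Finset.sum_mul]
    refine (Finset.sum_le_card_nsmul _ _ (5 / 4 * n.factorial * q ^ (s * k) * q ^ (k * n))
      fun i _ => ?_).trans (le_of_eq ?_)
    · have h := second_moment_le W hW i.1.1 i.1.2 i.2
      rw [Fintype.sum_prod_type]
      simpa only [Nat.card_eq_fintype_card, Fintype.card_subtype] using h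
    · rw [Finset.card_univ, Fintype.card_prod, Fintype.card_perm, Fintype.card_fin, nsmul_eq_mul]
      push_cast
      rfl
  have hcs := sq_sum_card_le R
  set X1 := ∑ i, (Finset.univ.filter fun G => R G i).card
  set X2 := ∑ i, ∑ j, (Finset.univ.filter fun G => R G i ∧ R G j).card
  set good := (Finset.univ.filter fun G => ∃ i, R G i).card with hgood
  have hcs' : (X1 : ℝ) ^ 2 ≤ good * X2 := by exact_mod_cast hcs
  have hmain : inj * q ^ (k * n) ≤ good * (5 / 4 * q ^ (s * k)) := by
    have hfac : (0 : ℝ) < n.factorial := by exact_mod_cast n.factorial_pos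
    have hp : 0 < inj * (n.factorial : ℝ) ^ 2 * q ^ (k * n) := by positivity
    refine le_of_mul_le_mul_left ?_ hp
    calc inj * (n.factorial : ℝ) ^ 2 * q ^ (k * n) * (inj * q ^ (k * n))
        = (inj * n.factorial * q ^ (k * n)) ^ 2 := by ring
      _ = (X1 : ℝ) ^ 2 * q ^ (2 * s * n) := by
          rw [← hfirst, mul_pow, ← pow_mul]; congr 2; ring
      _ ≤ good * X2 * q ^ (2 * s * n) := by
          refine mul_le_mul_of_nonneg_right hcs' (by positivity)
      _ = good * (X2 * q ^ (2 * s * n)) := by ring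
      _ ≤ good * (inj * n.factorial * (5 / 4 * n.factorial * q ^ (s * k) * q ^ (k * n))) := by
          refine mul_le_mul_of_nonneg_left hsecond (by positivity)
      _ = _ := by ring
  have hgood2 : good ≤ Nat.card {G : (Fin k → F) →ₗ[F] (Fin n → F) //
        ∃ π : Equiv.Perm (Fin n), W.map (LinearMap.funLeft F F π) ≤ LinearMap.range G} := by
    rw [Nat.card_eq_fintype_card, Fintype.card_subtype]
    refine Finset.card_le_card fun G hG => ?_
    simp only [Finset.mem_filter, Finset.mem_univ, true_and] at hG ⊢
    obtain ⟨⟨x, π⟩, hG⟩ := hG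
    refine ⟨π, ?_⟩
    rintro _ ⟨u, hu, rfl⟩
    exact ⟨x.1 ⟨u, hu⟩, LinearMap.congr_fun hG ⟨u, hu⟩⟩
  -- At least `3/4` of the maps `x` are injective and the second moment loses `5/4`, which leaves
  -- the proportion `3/5 ≥ 1/2`.
  have hfin : q ^ (k * n) ≤ 2 * good := by
    have h1 : 3 / 4 * q ^ (s * k) * q ^ (k * n) ≤ good * (5 / 4 * q ^ (s * k)) :=
      (mul_le_mul_of_nonneg_right hinj1 (by positivity)).trans hmain
    have hp : 0 < q ^ (s * k) := by positivity
    have h2 : 3 * q ^ (k * n) ≤ 5 * good := by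
      refine le_of_mul_le_mul_left ?_ hp
      linarith
    have : (0 : ℝ) ≤ good := by positivity
    linarith
  have : Fintype.card F ^ (k * n) ≤ 2 * good := by rw [hq] at hfin; exact_mod_cast hfin
  omega

end SecondMoment

/-! ### Orbits of tuples of words under coordinate permutations. -/

lemma fixCard_anti {X : Type*} {n : ℕ} {U V : Set (Fin n → X)} (h : U ⊆ V) :
    fixCard V ≤ fixCard U :=
  Nat.card_le_card_of_injective (fun π => ⟨π.1, fun u hu => π.2 u (h hu)⟩)
    fun _ _ h => Subtype.ext (Subtype.mk.inj h)

section Orbits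

variable {X : Type*} [Fintype X] {n : ℕ}

open Classical in
lemma exists_perm_of_card_fiber_eq (r r' : Fin n → X)
    (h : ∀ x, (Finset.univ.filter fun j => r j = x).card
      = (Finset.univ.filter fun j => r' j = x).card) :
    ∃ π : Equiv.Perm (Fin n), r' ∘ π = r := by
  have e : ∀ x, Nonempty ({j // r j = x} ≃ {j // r' j = x}) := fun x => by
    rw [← Fintype.card_eq, Fintype.card_subtype, Fintype.card_subtype, h x]
  refine ⟨Equiv.ofFiberEquiv fun x => (e x).some, ?_⟩
  funext j
  exact Equiv.ofFiberEquiv_map _ j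

open Classical in
/-- By Burnside's lemma and a count of empirical distributions. -/
lemma sum_card_perm_fixing_le :
    ∑ r : Fin n → X, Nat.card {π : Equiv.Perm (Fin n) // r ∘ π = r}
      ≤ n.factorial * (n + 1) ^ Fintype.card X := by
  let G := (Equiv.Perm (Fin n))ᵈᵐᵃ
  have : Fintype G := Fintype.ofEquiv (Equiv.Perm (Fin n)) DomMulAct.mk
  have hB := MulAction.sum_card_fixedBy_eq_card_orbits_mul_card_group G (Fin n → X)
  have hG : Fintype.card G = n.factorial := by
    rw [← Nat.card_eq_fintype_card, ← Nat.card_congr DomMulAct.mk, Nat.card_perm, Nat.card_fin]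
  have hO : Fintype.card (Quotient (MulAction.orbitRel G (Fin n → X))) ≤
      (n + 1) ^ Fintype.card X := by
    -- The number of occurrences of each letter determines the orbit of a word.
    let τ : Quotient (MulAction.orbitRel G (Fin n → X)) → (X → Fin (n + 1)) := fun o x =>
      ⟨(Finset.univ.filter fun j => o.out j = x).card, by
        have := Finset.card_le_univ (Finset.univ.filter fun j => o.out j = x)
        rw [Fintype.card_fin] at this
        omega⟩
    have hτ : Function.Injective τ := by
      intro o o' h
      obtain ⟨π, hπ⟩ := exists_perm_of_card_fiber_eq o.out o'.out fun x =>
        congrArg Fin.val (congrFun h x)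
      rw [← Quotient.out_eq o, ← Quotient.out_eq o']
      refine Quotient.sound ?_
      exact ⟨DomMulAct.mk π, hπ⟩
    refine (Fintype.card_le_of_injective τ hτ).trans (le_of_eq ?_)
    simp
  have hsum : ∑ r : Fin n → X, Nat.card {π : Equiv.Perm (Fin n) // r ∘ π = r}
      = ∑ a : G, Fintype.card (MulAction.fixedBy (Fin n → X) a) := by
    have h := Finset.sum_card_bipartiteAbove_eq_sum_card_bipartiteBelow
      (fun (r : Fin n → X) (a : G) => a • r = r) (s := Finset.univ) (t := Finset.univ)
    refine Eq.trans (Finset.sum_congr rfl fun r _ => ?_)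
      (h.trans (Finset.sum_congr rfl fun a _ => ?_))
    · rw [Finset.bipartiteAbove, ← Fintype.card_subtype, ← Nat.card_eq_fintype_card]
      exact Nat.card_congr (DomMulAct.mk.subtypeEquiv fun π => Iff.rfl)
    · rw [Finset.bipartiteBelow, ← Fintype.card_subtype]
      exact Fintype.card_congr (Equiv.refl _)
  rw [hsum, hB, hG, mul_comm]
  exact Nat.mul_le_mul_left _ hO

open Classical in
/-- Few tuples of words have a large fixing group. -/
lemma card_large_fixCard_le {d a c : ℕ} :
    (Finset.univ.filter fun z : Fin d → Fin n → X =>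
      n.factorial * a ≤ c * fixCard (Set.range z)).card * a
      ≤ c * (n + 1) ^ (Fintype.card X ^ d) := by
  have h1 : ∑ z : Fin d → Fin n → X, fixCard (Set.range z)
      ≤ n.factorial * (n + 1) ^ (Fintype.card X ^ d) := by
    have h := sum_card_perm_fixing_le (X := Fin d → X) (n := n)
    rw [Fintype.card_fun, Fintype.card_fin] at h
    refine le_trans (le_of_eq ?_) h
    -- Transposition turns a `d`-tuple of words over `X` into one word over `Fin d → X`; a
    -- permutation fixes the latter iff it fixes every word of the tuple.
    refine Fintype.sum_equiv (Equiv.piComm fun _ _ => X) _ _ fun z => ?_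
    refine Nat.card_congr (Equiv.subtypeEquivRight fun π => ?_)
    simp only [Set.forall_mem_range, funext_iff, Function.comp_apply, Equiv.piComm_apply]
    exact forall_comm
  refine Nat.le_of_mul_le_mul_left ?_ n.factorial_pos
  calc _ = ∑ z ∈ Finset.univ.filter (fun z : Fin d → Fin n → X =>
      n.factorial * a ≤ c * fixCard (Set.range z)), n.factorial * a := by
        rw [Finset.sum_const, smul_eq_mul]; ring
    _ ≤ ∑ z ∈ Finset.univ.filter (fun z : Fin d → Fin n → X =>
      n.factorial * a ≤ c * fixCard (Set.range z)), c * fixCard (Set.range z) :=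
        Finset.sum_le_sum fun z hz => (Finset.mem_filter.1 hz).2
    _ ≤ ∑ z : Fin d → Fin n → X, c * fixCard (Set.range z) :=
        Finset.sum_le_sum_of_subset (Finset.filter_subset _ _)
    _ = c * ∑ z : Fin d → Fin n → X, fixCard (Set.range z) := by rw [Finset.mul_sum]
    _ ≤ c * (n.factorial * (n + 1) ^ (Fintype.card X ^ d)) := Nat.mul_le_mul_left _ h1
    _ = _ := by ring

end Orbits

/-! ### Codes in a local property below its threshold. -/

lemma prob_map_uniform {α β : Type*} [Fintype α] [Nonempty α] (f : α → β) (S : Set β) :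
    prob ((PMF.uniformOfFintype α).map f) S = (Nat.card {a // f a ∈ S} : ℝ) / Fintype.card α := by
  classical
  rw [prob, PMF.toOuterMeasure_map_apply, PMF.toOuterMeasure_uniformOfFintype_apply,
    ENNReal.toReal_div, ENNReal.toReal_natCast, ENNReal.toReal_natCast, Nat.card_eq_fintype_card]
  rfl

section Threshold

variable {F : Type*} [Field F] [Fintype F] {n k b : ℕ}

lemma prob_randomLinearCode (P : CodeProperty F n) :
    prob (randomLinearCode F k n) P =
      (Nat.card {G : (Fin k → F) →ₗ[F] (Fin n → F) // LinearMap.range G ∈ P} : ℝ) /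
        (Fintype.card F : ℝ) ^ (k * n) := by
  classical
  rw [randomLinearCode, prob_map_uniform]
  congr 2
  · refine Nat.card_congr (Matrix.toLinearMapRight'.toEquiv.subtypeEquiv fun A => ?_)
    have : LinearMap.range (Matrix.toLinearMapRight' A) = Submodule.span F (Set.range A.row) :=
      _root_.range_vecMulLinear A
    simp [this]
  · have : Fintype.card (Matrix (Fin k) (Fin n) F) = Fintype.card F ^ (k * n) := by
      rw [← Nat.card_eq_fintype_card, Nat.card_congr Matrix.toLinearMapRight'.toEquiv,
        card_linearMap, finrank_fin_fun, finrank_fin_fun]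
    rw [this]; push_cast; rfl

lemma exists_linearIndependent_tuple {V : Type*} [AddCommGroup V] [Module F V] [Finite V]
    (W : Submodule F V) (U : Submodule F W) :
    ∃ z : Fin (finrank F U) → V, LinearIndependent F z ∧ ∀ t, z t ∈ U.map W.subtype := by
  rw [← Submodule.finrank_map_subtype_eq W U]
  exact ⟨fun t => (finBasis F (U.map W.subtype) t : V),
    (finBasis F (U.map W.subtype)).linearIndependent.map' _ (Submodule.ker_subtype _),
    fun t => (finBasis F (U.map W.subtype) t).2⟩

/-- Below the threshold, every code in a local property contains a short tuple of words with a
large fixing group. -/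
theorem exists_tuple_large_fixCard {P : CodeProperty F n} (hmono : MonotoneIncreasing P)
    (hsymm : RowSymmetric P) (hloc : IsLocal b P) (hk : b + 2 ≤ k)
    (hprob : prob (randomLinearCode F k n) P < 1 / 2) {C : LinearCode F n} (hC : C ∈ P) :
    ∃ d, 1 ≤ d ∧ d ≤ b ∧ ∃ z : Fin d → Fin n → F, LinearIndependent F z ∧ (∀ t, z t ∈ C) ∧
      n.factorial * Fintype.card F ^ (k * d) ≤
        4 * Fintype.card F ^ (2 * b ^ 2) * Fintype.card F ^ (n * d) * fixCard (Set.range z) := by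
  obtain ⟨𝓑, hb, hP⟩ := hloc
  obtain ⟨B, hB, hBC⟩ := (hP C).1 hC
  obtain ⟨W, hWdef⟩ : ∃ W : LinearCode F n, W = Submodule.span F B := ⟨_, rfl⟩
  have hWC : W ≤ C := hWdef ▸ Submodule.span_le.2 hBC
  have hWP : W ∈ P := (hP W).2 ⟨B, hB, hWdef ▸ Submodule.subset_span⟩
  have hWb : finrank F W ≤ b := by
    have hfin : B.Finite := B.toFinite
    have := hfin.fintype
    have h1 := finrank_span_le_card (R := F) B
    have h2 := hb B hB
    rw [Set.encard_eq_coe_toFinset_card] at h2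
    rw [hWdef]
    exact h1.trans (by exact_mod_cast h2)
  have hq : 1 ≤ Fintype.card F := Fintype.card_pos
  by_contra hcon
  -- If some nonzero `U ≤ W` violates the second moment condition, a basis of `U` is the required
  -- tuple; it spans less than or equal to `U`, so its fixing group is at least as large.
  have hA := half_le_card_contains_perm (k := k) W (by omega) fun U hU => by
    by_contra hlt
    push Not at hlt
    obtain ⟨z, hz, hzU⟩ := exists_linearIndependent_tuple W U
    refine hcon ⟨finrank F U, ?_, (Submodule.finrank_le U).trans hWb, z, hz,
      fun t => hWC (Submodule.map_subtype_le W U (hzU t)), ?_⟩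
    · exact Nat.one_le_iff_ne_zero.2 fun h => hU (Submodule.finrank_eq_zero.1 h)
    · refine hlt.le.trans ?_
      refine Nat.mul_le_mul (Nat.mul_le_mul_right _ ?_) (fixCard_anti ?_)
      · rw [mul_assoc]
        refine Nat.mul_le_mul_left _ ?_
        refine (Nat.mul_le_mul_right _ card_submodule_le).trans ?_
        rw [← pow_add]
        -- With `s = dim W ≤ b`, the number of subspaces costs `s ^ 2` in the exponent and the other
        -- factor `s * dim U`, together at most `2 b ^ 2`.
        refine Nat.pow_le_pow_right hq ?_
        have := Submodule.finrank_le U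
        nlinarith
      · rintro _ ⟨t, rfl⟩
        exact hzU t
  have hle : Nat.card {G : (Fin k → F) →ₗ[F] (Fin n → F) //
        ∃ π : Equiv.Perm (Fin n), W.map (LinearMap.funLeft F F π) ≤ LinearMap.range G} ≤
      Nat.card {G : (Fin k → F) →ₗ[F] (Fin n → F) // LinearMap.range G ∈ P} :=
    Nat.card_le_card_of_injective
      (fun G => ⟨G.1, G.2.elim fun π h => hmono h (hsymm W hWP π)⟩)
      fun _ _ h => Subtype.ext (Subtype.mk.inj h)
  rw [prob_randomLinearCode, div_lt_iff₀ (by positivity)] at hprob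
  have h1 : (Fintype.card F : ℝ) ^ (k * n) ≤ 2 *
      (Nat.card {G : (Fin k → F) →ₗ[F] (Fin n → F) // LinearMap.range G ∈ P} : ℝ) := by
    exact_mod_cast hA.trans (Nat.mul_le_mul_left _ hle)
  linarith

end Threshold

/-! ### Near-uniformity of a random coordinate of independent codewords. -/

section Puncturing

variable {F : Type*} [Field F] [Fintype F] {m n d : ℕ}

/-- If `A` is a subspace of linear combinations of the words `v` and every nonzero word in it has
weight close to optimal, then few coordinates are annihilated by all of `A`. -/
lemma card_annihilated_mul_le (D : LinearCode F m) {η : ℝ} (hη : 0 ≤ η)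
    (hD : HasOptimalDistance η D) (v : (Fin d → F) →ₗ[F] (Fin m → F))
    (hv : Function.Injective v) (hvD : ∀ a, v a ∈ D) (A : Submodule F (Fin d → F)) :
    (Nat.card {i : Fin m // ∀ a ∈ A, v a i = 0} : ℝ) * (Fintype.card F : ℝ) ^ finrank F A
      ≤ m * (1 + η * (Fintype.card F : ℝ) ^ finrank F A) := by
  classical
  have := Fintype.ofFinite A
  set q : ℝ := (Fintype.card F : ℝ) with hq
  have hq2 : 2 ≤ q := by
    have : 2 ≤ Fintype.card F := Fintype.one_lt_card
    rw [hq]; exact_mod_cast this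
  set Q : ℝ := q ^ finrank F A with hQ
  have hQ1 : 1 ≤ Q := one_le_pow₀ (by linarith)
  have hcardA : (Fintype.card A : ℝ) = Q := by
    rw [← Nat.card_eq_fintype_card, Module.natCard_eq_pow_finrank (K := F),
      Nat.card_eq_fintype_card, hQ, hq]
    push_cast; rfl
  -- zeros of a single word
  have hz : ∀ a : A, (q * (Finset.univ.filter fun i : Fin m => v a i = 0).card : ℝ)
      ≤ m * (1 + (q - 1) * η) + if a = 0 then m * (q - 1) * (1 - η) else 0 := by
    intro a
    by_cases ha : a = 0
    · subst ha
      simp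
      nlinarith
    · rw [if_neg ha, add_zero]
      have hne : v a ≠ 0 := fun h => ha (Subtype.ext (hv (by simpa using h)))
      have hw := hD (v a) (hvD a) hne
      rw [normalizedWeight] at hw
      have hsum : (Finset.univ.filter fun i : Fin m => v a i = 0).card + hammingNorm (v a) = m := by
        have := Finset.card_filter_add_card_filter_not (s := (Finset.univ : Finset (Fin m)))
          (fun i => v a i = 0)
        rw [Finset.card_univ, Fintype.card_fin] at this
        convert this using 2
        simp [hammingNorm]
      have hm : (0 : ℝ) < m := by
        rcases Nat.eq_zero_or_pos m with h | h
        · subst h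
          exact absurd (Subsingleton.elim _ _) hne
        · exact_mod_cast h
      have hsum' : ((Finset.univ.filter fun i : Fin m => v a i = 0).card : ℝ)
          + (hammingNorm (v a) : ℝ) = m := by exact_mod_cast hsum
      have hw' : (q - 1) * (1 - η) * m ≤ q * (hammingNorm (v a) : ℝ) := by
        have h := hw
        rw [div_le_div_iff₀ (by linarith) hm] at h
        convert h.trans (le_of_eq (mul_comm _ _)) using 3
      have : (q * (Finset.univ.filter fun i : Fin m => v a i = 0).card : ℝ)
          = q * m - q * (hammingNorm (v a) : ℝ) := by rw [← hsum']; ring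
      rw [this]
      nlinarith
  -- words vanishing at a single coordinate
  have hi : ∀ i : Fin m, (if ∀ a ∈ A, v a i = 0 then (q - 1) * Q else 0) + Q ≤
      q * (Finset.univ.filter fun a : A => v a i = 0).card := by
    intro i
    let φ : A →ₗ[F] F := LinearMap.proj i ∘ₗ v ∘ₗ A.subtype
    split_ifs with h
    · have : (Finset.univ.filter fun a : A => v a i = 0) = Finset.univ :=
        Finset.filter_true_of_mem fun a _ => h a a.2
      rw [this, Finset.card_univ, hcardA]
      linarith
    · have hker : ((Finset.univ.filter fun a : A => v a i = 0).card : ℝ)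
          = q ^ finrank F (LinearMap.ker φ) := by
        have h1 : (Finset.univ.filter fun a : A => v a i = 0).card
            = Nat.card (LinearMap.ker φ) := by
          rw [← Nat.card_eq_finsetCard]
          exact Nat.card_congr (Equiv.subtypeEquivRight fun a => by simp [φ])
        rw [h1, Module.natCard_eq_pow_finrank (K := F), Nat.card_eq_fintype_card, hq]
        push_cast; rfl
      have hr := φ.finrank_range_add_finrank_ker
      have hle : finrank F (LinearMap.range φ) ≤ 1 := by
        simpa using (LinearMap.range φ).finrank_le
      rw [hker, ← pow_succ', zero_add]
      exact pow_le_pow_right₀ (by linarith) (by omega)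
  -- Double count of the pairs `(i, a)` with `v a i = 0`: every coordinate kills at least `|A| / q`
  -- of the words, an annihilated one kills all of them, while a nonzero word has few zeros.
  have hdc : ∑ i : Fin m, ((Finset.univ.filter fun a : A => v a i = 0).card : ℝ)
      = ∑ a : A, ((Finset.univ.filter fun i : Fin m => v a i = 0).card : ℝ) := by
    have := Finset.sum_card_bipartiteAbove_eq_sum_card_bipartiteBelow
      (fun (i : Fin m) (a : A) => v a i = 0) (s := Finset.univ) (t := Finset.univ)
    exact_mod_cast this
  have hlow := Finset.sum_le_sum fun i (_ : i ∈ Finset.univ) => hi i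
  have hup := Finset.sum_le_sum fun a (_ : a ∈ Finset.univ) => hz a
  rw [← Finset.mul_sum, Finset.sum_add_distrib, Finset.sum_const, ← Finset.sum_filter,
    Finset.sum_const, Finset.card_univ, Fintype.card_fin, nsmul_eq_mul, nsmul_eq_mul, hdc] at hlow
  rw [← Finset.mul_sum, Finset.sum_add_distrib, Finset.sum_const, Finset.card_univ,
    nsmul_eq_mul, hcardA, Finset.sum_ite_eq' Finset.univ 0, if_pos (Finset.mem_univ _)] at hup
  rw [Nat.card_eq_fintype_card, Fintype.card_subtype]
  set c : ℝ := ((Finset.univ.filter fun i : Fin m => ∀ a ∈ A, v a i = 0).card : ℝ)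
  have hfin : (q - 1) * (c * Q) ≤ (q - 1) * (m * (1 + η * Q)) := by
    have hmη : 0 ≤ (m : ℝ) * (q - 1) * η := by
      have : 0 ≤ q - 1 := by linarith
      positivity
    nlinarith
  exact le_of_mul_le_mul_left hfin (by linarith)

/-- Up to a random nonzero scalar, a uniformly random coordinate of a tuple of independent
codewords takes each value with probability at most four times the uniform one. -/
lemma card_scaled_coordinate_le [NeZero m] (D : LinearCode F m) {b : ℕ} (hdb : d ≤ b)
    (hD : HasOptimalDistance ((Fintype.card F : ℝ) ^ (-(b : ℝ))) D)
    (v : Fin d → Fin m → F) (hv : LinearIndependent F v) (hvD : ∀ t, v t ∈ D)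
    (y : Fin d → F) :
    (Nat.card {p : Fin m × Fˣ // ∀ t, (p.2 : F) * v t p.1 = y t} : ℝ) *
      (Fintype.card F : ℝ) ^ d ≤ 4 * (m * ((Fintype.card F : ℝ) - 1)) := by
  classical
  set q : ℝ := (Fintype.card F : ℝ) with hq
  have hq2 : 2 ≤ q := by
    have : 2 ≤ Fintype.card F := Fintype.one_lt_card
    rw [hq]; exact_mod_cast this
  have hunits : (Fintype.card Fˣ : ℝ) = q - 1 := by
    rw [Fintype.card_units, Nat.cast_sub Fintype.card_pos, hq]; simp
  have hη0 : 0 ≤ q ^ (-(b : ℝ)) := by positivity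
  have hηd : q ^ (-(b : ℝ)) * q ^ d ≤ 1 := by
    rw [Real.rpow_neg (by linarith), Real.rpow_natCast, inv_mul_le_iff₀ (by positivity), mul_one]
    exact pow_le_pow_right₀ (by linarith) hdb
  let w : (Fin d → F) →ₗ[F] (Fin m → F) := Fintype.linearCombination F v
  have hw : Function.Injective w := linearIndependent_iff_injective_fintypeLinearCombination.1 hv
  have hwD : ∀ a, w a ∈ D := fun a => by
    simp only [w, Fintype.linearCombination_apply]
    exact D.sum_mem fun t _ => D.smul_mem _ (hvD t)
  have hwi : ∀ a i, w a i = ∑ t, a t * v t i := fun a i => by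
    simp [w, Fintype.linearCombination_apply]
  have hm : (0 : ℝ) < m := by exact_mod_cast Nat.pos_of_ne_zero (NeZero.ne m)
  by_cases hy : y = 0
  · have h1 := card_annihilated_mul_le D hη0 hD w hw hwD ⊤
    rw [finrank_top, finrank_fin_fun, ← hq] at h1
    have h2 : Nat.card {p : Fin m × Fˣ // ∀ t, (p.2 : F) * v t p.1 = y t} ≤
        Nat.card {i : Fin m // ∀ a ∈ (⊤ : Submodule F (Fin d → F)), w a i = 0} *
          Fintype.card Fˣ := by
      rw [← Nat.card_eq_fintype_card, ← Nat.card_prod]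
      refine Nat.card_le_card_of_injective (fun p => (⟨p.1.1, fun a _ => ?_⟩, p.1.2)) ?_
      · rw [hwi]
        refine Finset.sum_eq_zero fun t _ => ?_
        have := (p.2 t).trans (congrFun hy t)
        rw [Pi.zero_apply, Units.mul_right_eq_zero] at this
        rw [this, mul_zero]
      · intro p p' h
        exact Subtype.ext (Prod.ext (Subtype.mk.inj (Prod.mk.inj h).1) (Prod.mk.inj h).2)
    have h2' : (Nat.card {p : Fin m × Fˣ // ∀ t, (p.2 : F) * v t p.1 = y t} : ℝ) ≤
        (Nat.card {i : Fin m // ∀ a ∈ (⊤ : Submodule F (Fin d → F)), w a i = 0} : ℝ) *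
          (q - 1) := by rw [← hunits]; exact_mod_cast h2
    set c := (Nat.card {i : Fin m // ∀ a ∈ (⊤ : Submodule F (Fin d → F)), w a i = 0} : ℝ)
    calc _ ≤ c * (q - 1) * q ^ d := mul_le_mul_of_nonneg_right h2' (by positivity)
      _ = c * q ^ d * (q - 1) := by ring
      _ ≤ m * (1 + q ^ (-(b : ℝ)) * q ^ d) * (q - 1) :=
        mul_le_mul_of_nonneg_right h1 (by linarith)
      _ ≤ m * 4 * (q - 1) := by
        refine mul_le_mul_of_nonneg_right ?_ (by linarith)
        refine mul_le_mul_of_nonneg_left ?_ hm.le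
        linarith
      _ = _ := by ring
  -- If the scaled coordinate equals `y ≠ 0`, then every combination in the kernel of `ψ` vanishes
  -- at `i`, and the scalar is determined by `i` through a nonzero entry of `y`. The kernel has
  -- dimension at least `d - 1`; the lost factor `q` is absorbed by `q ≤ 2 (q - 1)`.
  · let ψ : (Fin d → F) →ₗ[F] F := Fintype.linearCombination F y
    have hψ : ∀ a, ψ a = ∑ t, a t * y t := fun a => by
      simp [ψ, Fintype.linearCombination_apply]
    have hrange : finrank F (LinearMap.range ψ) ≤ 1 := by
      simpa using (LinearMap.range ψ).finrank_le
    have hker := ψ.finrank_range_add_finrank_ker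
    rw [finrank_fin_fun] at hker
    have h1 := card_annihilated_mul_le D hη0 hD w hw hwD (LinearMap.ker ψ)
    rw [← hq] at h1
    set e := finrank F (LinearMap.ker ψ)
    have he : e = d ∨ e + 1 = d := by omega
    obtain ⟨t₀, ht₀⟩ : ∃ t, y t ≠ 0 := by
      by_contra h
      push Not at h
      exact hy (funext h)
    have h2 : Nat.card {p : Fin m × Fˣ // ∀ t, (p.2 : F) * v t p.1 = y t} ≤
        Nat.card {i : Fin m // ∀ a ∈ LinearMap.ker ψ, w a i = 0} := by
      refine Nat.card_le_card_of_injective (fun p => ⟨p.1.1, fun a ha => ?_⟩) ?_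
      · rw [LinearMap.mem_ker, hψ] at ha
        refine (Units.mul_right_eq_zero p.1.2).1 ?_
        rw [hwi, Finset.mul_sum, ← ha]
        refine Finset.sum_congr rfl fun t _ => ?_
        rw [← p.2 t]; ring
      · intro p p' h
        have h1 : p.1.1 = p'.1.1 := Subtype.mk.inj h
        refine Subtype.ext (Prod.ext h1 (Units.ext ?_))
        have e1 := p.2 t₀
        have e2 := p'.2 t₀
        rw [← h1] at e2
        have hv0 : v t₀ p.1.1 ≠ 0 := fun h => ht₀ (by rw [← e1, h, mul_zero])
        exact mul_right_cancel₀ hv0 (e1.trans e2.symm)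
    have h2' : (Nat.card {p : Fin m × Fˣ // ∀ t, (p.2 : F) * v t p.1 = y t} : ℝ) ≤
        (Nat.card {i : Fin m // ∀ a ∈ LinearMap.ker ψ, w a i = 0} : ℝ) := by exact_mod_cast h2
    set c := (Nat.card {i : Fin m // ∀ a ∈ LinearMap.ker ψ, w a i = 0} : ℝ)
    have hc0 : 0 ≤ c := by positivity
    have hle : q ^ d ≤ q * q ^ e := by
      rw [← pow_succ']
      exact pow_le_pow_right₀ (by linarith) (by omega)
    have hηe : q * (q ^ (-(b : ℝ)) * q ^ e) ≤ q := by
      have : q ^ (-(b : ℝ)) * q ^ e ≤ 1 := by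
        refine le_trans (mul_le_mul_of_nonneg_left ?_ hη0) hηd
        exact pow_le_pow_right₀ (by linarith) (by omega)
      nlinarith
    calc _ ≤ c * (q * q ^ e) := mul_le_mul h2' hle (by positivity) hc0
      _ = q * (c * q ^ e) := by ring
      _ ≤ q * (m * (1 + q ^ (-(b : ℝ)) * q ^ e)) := by gcongr
      _ = m * (q + q * (q ^ (-(b : ℝ)) * q ^ e)) := by ring
      _ ≤ m * (4 * (q - 1)) := by
        refine mul_le_mul_of_nonneg_left ?_ hm.le
        linarith
      _ = _ := by ring

end Puncturing

/-! ### The union bound over tuples for scaled puncturings. -/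

section UnionBound

variable {F : Type*} [Field F] [Fintype F] {m n b : ℕ}

/-- The puncturing given by the first components of `p`, followed by the coordinate scaling given
by the second ones. -/
def scaledPuncture (p : Fin n → Fin m × Fˣ) : (Fin m → F) →ₗ[F] (Fin n → F) where
  toFun u j := (p j).2 * u (p j).1
  map_add' u u' := by ext j; simp [mul_add]
  map_smul' c u := by ext j; simp [mul_left_comm]

lemma map_scaledPuncture_mem {P : CodeProperty F n} (hP : ScalarInvariant P)
    (D : LinearCode F m) (p : Fin n → Fin m × Fˣ)
    (h : D.map (LinearMap.funLeft F F fun j => (p j).1) ∈ P) : D.map (scaledPuncture p) ∈ P := by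
  classical
  have h1 := hP _ h (Matrix.diagonal fun j => ((p j).2 : F)) (Matrix.isDiag_diagonal _) (by
    have hu : IsUnit (Matrix.diagonal fun j => ((p j).2 : F)) := by
      rw [Matrix.isUnit_diagonal, Pi.isUnit_iff]
      exact fun j => (p j).2.isUnit
    rw [Matrix.rank_of_isUnit _ hu, Fintype.card_fin])
  rw [← Submodule.map_comp] at h1
  have e : scaledPuncture p = (Matrix.diagonal fun j => ((p j).2 : F)).mulVecLin ∘ₗ
      LinearMap.funLeft F F fun j => (p j).1 := by
    refine LinearMap.ext fun u => funext fun j => ?_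
    simp [scaledPuncture, Matrix.mulVec_diagonal, LinearMap.funLeft_apply]
  rwa [e]

-- The constraints at different coordinates involve different components of `p`, so the count is a
-- product of `n` single-coordinate counts.
open Classical in
lemma card_scaledPuncture_eq_le [NeZero m] (D : LinearCode F m) {d : ℕ} (hdb : d ≤ b)
    (hD : HasOptimalDistance ((Fintype.card F : ℝ) ^ (-(b : ℝ))) D)
    (v : Fin d → Fin m → F) (hv : LinearIndependent F v) (hvD : ∀ t, v t ∈ D)
    (z : Fin d → Fin n → F) :
    ((Finset.univ.filter fun p : Fin n → Fin m × Fˣ =>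
        ∀ t, scaledPuncture p (v t) = z t).card : ℝ)
      ≤ (4 * (m * ((Fintype.card F : ℝ) - 1)) / (Fintype.card F : ℝ) ^ d) ^ n := by
  have hq : (0 : ℝ) < Fintype.card F := by exact_mod_cast Fintype.card_pos
  have h1 : (Finset.univ.filter fun p : Fin n → Fin m × Fˣ =>
        ∀ t, scaledPuncture p (v t) = z t) =
      Fintype.piFinset fun j => Finset.univ.filter fun r : Fin m × Fˣ =>
        ∀ t, (r.2 : F) * v t r.1 = z t j := by
    ext p
    simp only [Finset.mem_filter, Finset.mem_univ, true_and, Fintype.mem_piFinset, funext_iff]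
    exact forall_comm
  rw [h1, Fintype.card_piFinset]
  push_cast
  refine (Finset.prod_le_prod (fun j _ => by positivity) fun j _ => ?_).trans
    (le_of_eq (by rw [Finset.prod_const, Finset.card_univ, Fintype.card_fin]))
  rw [le_div_iff₀ (by positivity)]
  have h := card_scaled_coordinate_le D hdb hD v hv hvD fun t => z t j
  rwa [Nat.card_eq_fintype_card, Fintype.card_subtype] at h

open Classical in
/-- The union bound for random puncturings. -/
theorem prob_randomPuncturing_le [NeZero m] {P : CodeProperty F n} (hP : ScalarInvariant P)
    (D : LinearCode F m) (hD : HasOptimalDistance ((Fintype.card F : ℝ) ^ (-(b : ℝ))) D)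
    (Z : ∀ d : ℕ, Finset (Fin d → Fin n → F))
    (hZ : ∀ C ∈ P, ∃ d, 1 ≤ d ∧ d ≤ b ∧ ∃ z ∈ Z d, LinearIndependent F z ∧ ∀ t, z t ∈ C) :
    prob (randomPuncturing D n) P ≤
      ∑ d ∈ Finset.Icc 1 b, ((Z d).card : ℝ) *
        ((Nat.card D : ℝ) ^ d * (4 / (Fintype.card F : ℝ) ^ d) ^ n) := by
  set q : ℝ := (Fintype.card F : ℝ) with hq
  have hq2 : 2 ≤ q := by
    have : 2 ≤ Fintype.card F := Fintype.one_lt_card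
    rw [hq]; exact_mod_cast this
  have hunits : (Fintype.card Fˣ : ℝ) = q - 1 := by
    rw [Fintype.card_units, Nat.cast_sub Fintype.card_pos, hq]; simp
  have hm : (0 : ℝ) < m := by exact_mod_cast Nat.pos_of_ne_zero (NeZero.ne m)
  have := Fintype.ofFinite D
  set good : Finset (Fin n → Fin m) := Finset.univ.filter fun i =>
    D.map (LinearMap.funLeft F F i) ∈ P with hgood
  -- Each good puncturing is counted with all its `(q - 1) ^ n` scalings, which remain in `P` by
  -- scalar invariance.
  set T : Finset (Fin n → Fin m × Fˣ) := Finset.univ.filter fun p =>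
    (fun j => (p j).1) ∈ good with hT
  have hTcard : (T.card : ℝ) = good.card * (q - 1) ^ n := by
    have : T.card = good.card * Fintype.card Fˣ ^ n := by
      have e1 : T.card = (good ×ˢ (Finset.univ : Finset (Fin n → Fˣ))).card := by
        refine Finset.card_bij' (fun p _ => (fun j => (p j).1, fun j => (p j).2))
          (fun r _ j => (r.1 j, r.2 j)) ?_ ?_ ?_ ?_
        · intro p hp
          exact Finset.mem_product.2 ⟨(Finset.mem_filter.1 hp).2, Finset.mem_univ _⟩
        · intro r hr
          exact Finset.mem_filter.2 ⟨Finset.mem_univ _, (Finset.mem_product.1 hr).1⟩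
        · intro p _; rfl
        · intro r _; rfl
      rw [e1, Finset.card_product, Finset.card_univ, Fintype.card_fun, Fintype.card_fin]
    rw [this, ← hunits]; push_cast; rfl
  have hcover : T ⊆ (Finset.Icc 1 b).biUnion fun d => (Z d).biUnion fun z =>
      (Finset.univ.filter fun v : Fin d → D =>
        LinearIndependent F fun t => (v t : Fin m → F)).biUnion fun v =>
        Finset.univ.filter fun p : Fin n → Fin m × Fˣ =>
          ∀ t, scaledPuncture p (v t : Fin m → F) = z t := by
    intro p hp
    have hp' := (Finset.mem_filter.1 (Finset.mem_filter.1 hp).2).2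
    obtain ⟨d, hd1, hdb, z, hzZ, hz, hzC⟩ := hZ _ (map_scaledPuncture_mem hP D p hp')
    choose u huD hu using hzC
    simp only [Finset.mem_biUnion, Finset.mem_filter, Finset.mem_univ, true_and, Finset.mem_Icc]
    refine ⟨d, ⟨hd1, hdb⟩, z, hzZ, fun t => ⟨u t, huD t⟩, ?_, hu⟩
    -- Independence of the images forces independence of the chosen preimages in `D`, as the
    -- single-coordinate estimate requires.
    refine LinearIndependent.of_comp (scaledPuncture p) ?_
    convert hz using 1
    exact funext hu
  set β : ℕ → ℝ := fun d => (4 * (m * (q - 1)) / q ^ d) ^ n with hβ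
  have hq1 : 0 < q - 1 := by linarith
  have hbound : (T.card : ℝ) ≤ ∑ d ∈ Finset.Icc 1 b,
      ((Z d).card : ℝ) * ((Nat.card D : ℝ) ^ d * β d) := by
    refine (Nat.cast_le.2 ((Finset.card_le_card hcover).trans Finset.card_biUnion_le)).trans ?_
    push_cast
    refine Finset.sum_le_sum fun d hd => ?_
    refine (Nat.cast_le.2 Finset.card_biUnion_le).trans ?_
    push_cast
    rw [← nsmul_eq_mul]
    refine Finset.sum_le_card_nsmul _ _ _ fun z _ => ?_
    refine (Nat.cast_le.2 Finset.card_biUnion_le).trans ?_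
    push_cast
    refine (Finset.sum_le_card_nsmul _ _ (β d) fun v hv => ?_).trans ?_
    · exact card_scaledPuncture_eq_le D (Finset.mem_Icc.1 hd).2 hD _ (Finset.mem_filter.1 hv).2
        (fun t => (v t).2) z
    · rw [nsmul_eq_mul]
      refine mul_le_mul_of_nonneg_right ?_ (by positivity)
      have h := Finset.card_le_univ (Finset.univ.filter fun v : Fin d → D =>
        LinearIndependent F fun t => (v t : Fin m → F))
      rw [Fintype.card_fun, Fintype.card_fin, ← Nat.card_eq_fintype_card (α := D)] at h
      exact_mod_cast h
  have hprob : prob (randomPuncturing D n) P = good.card / (m : ℝ) ^ n := by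
    rw [randomPuncturing, prob_map_uniform, Nat.card_eq_fintype_card, Fintype.card_subtype,
      Fintype.card_fun, Fintype.card_fin, Fintype.card_fin]
    push_cast; rfl
  rw [hprob, div_le_iff₀ (by positivity)]
  refine le_of_mul_le_mul_right ?_ (by positivity : 0 < (q - 1) ^ n)
  rw [← hTcard]
  refine hbound.trans (le_of_eq ?_)
  rw [mul_assoc, Finset.sum_mul]
  refine Finset.sum_congr rfl fun d _ => ?_
  rw [hβ]
  simp only [div_pow, mul_pow]
  ring

end UnionBound

/-! ### Choice of the comparison dimension and estimates of lower order terms. -/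

section Final

variable {F : Type*} [Field F] [Fintype F] {m n b k : ℕ}

lemma prob_le_one {α : Type*} (μ : PMF α) (S : Set α) : prob μ S ≤ 1 := by
  have h : μ.toOuterMeasure S ≤ 1 := by
    rw [← (PMF.tsum_coe μ), PMF.toOuterMeasure_apply]
    exact ENNReal.tsum_le_tsum fun a => Set.indicator_le_self _ _ a
  simpa [prob] using ENNReal.toReal_mono ENNReal.one_ne_top h

lemma rlcThreshold_le_one (P : CodeProperty F n) : rlcThreshold P ≤ 1 := by
  unfold rlcThreshold
  rcases Set.eq_empty_or_nonempty {R : ℝ | 0 ≤ R ∧ R ≤ 1 ∧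
    ∃ k : ℕ, (k : ℝ) = R * n ∧ 1 / 2 ≤ prob (randomLinearCode F k n) P} with h | ⟨R, hR⟩
  -- The real infimum of the empty set is `0` by convention.
  · rw [h, Real.sInf_empty]; exact zero_le_one
  · exact (csInf_le ⟨0, fun _ h => h.1⟩ hR).trans hR.2.1

lemma prob_lt_half_of_lt_rlcThreshold (P : CodeProperty F n)
    (hk : (k : ℝ) < rlcThreshold P * n) : prob (randomLinearCode F k n) P < 1 / 2 := by
  have hn : (0 : ℝ) < n := by
    rcases Nat.eq_zero_or_pos n with h | h
    · subst h
      simp only [Nat.cast_zero, mul_zero] at hk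
      exact absurd hk (not_lt.2 (Nat.cast_nonneg k))
    · exact_mod_cast h
  by_contra hge
  push Not at hge
  have hle : rlcThreshold P ≤ k / n := by
    refine csInf_le ⟨0, fun _ h => h.1⟩ ⟨by positivity, ?_, k, ?_, hge⟩
    · rw [div_le_one hn]
      nlinarith [rlcThreshold_le_one P]
    · field_simp
  rw [le_div_iff₀ hn] at hle
  linarith

lemma prob_randomPuncturing_le_of_lt_half [NeZero m] {P : CodeProperty F n}
    (hmono : MonotoneIncreasing P) (hsymm : RowSymmetric P) (hloc : IsLocal b P)
    (hscal : ScalarInvariant P) (hk : b + 2 ≤ k)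
    (hprob : prob (randomLinearCode F k n) P < 1 / 2) (D : LinearCode F m)
    (hD : HasOptimalDistance ((Fintype.card F : ℝ) ^ (-(b : ℝ))) D) :
    prob (randomPuncturing D n) P ≤
      ∑ d ∈ Finset.Icc 1 b, 4 * (Fintype.card F : ℝ) ^ (2 * b ^ 2) *
        ((n : ℝ) + 1) ^ (Fintype.card F ^ d) * 4 ^ n *
          ((Nat.card D : ℝ) / (Fintype.card F : ℝ) ^ k) ^ d := by
  classical
  have hq : (0 : ℝ) < Fintype.card F := by exact_mod_cast Fintype.card_pos
  refine (prob_randomPuncturing_le hscal D hD (fun d => Finset.univ.filter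
    fun z : Fin d → Fin n → F => n.factorial * Fintype.card F ^ (k * d) ≤
      4 * Fintype.card F ^ (2 * b ^ 2) * Fintype.card F ^ (n * d) * fixCard (Set.range z))
    fun C hC => ?_).trans (Finset.sum_le_sum fun d _ => ?_)
  · obtain ⟨d, h1, h2, z, hz, hzC, hf⟩ :=
      exists_tuple_large_fixCard hmono hsymm hloc hk hprob hC
    exact ⟨d, h1, h2, z, Finset.mem_filter.2 ⟨Finset.mem_univ _, hf⟩, hz, hzC⟩
  · have h := card_large_fixCard_le (X := F) (n := n) (d := d) (a := Fintype.card F ^ (k * d))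
      (c := 4 * Fintype.card F ^ (2 * b ^ 2) * Fintype.card F ^ (n * d))
    set Z := (Finset.univ.filter
      fun z : Fin d → Fin n → F => n.factorial * Fintype.card F ^ (k * d) ≤
      4 * Fintype.card F ^ (2 * b ^ 2) * Fintype.card F ^ (n * d) * fixCard (Set.range z)).card
    have h' : (Z : ℝ) * (Fintype.card F : ℝ) ^ (k * d) ≤ 4 * (Fintype.card F : ℝ) ^ (2 * b ^ 2) *
        (Fintype.card F : ℝ) ^ (n * d) * ((n : ℝ) + 1) ^ (Fintype.card F ^ d) := by
      exact_mod_cast h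
    rw [← le_div_iff₀ (by positivity)] at h'
    refine (mul_le_mul_of_nonneg_right h' (by positivity)).trans (le_of_eq ?_)
    rw [div_pow, div_pow, ← pow_mul, ← pow_mul, mul_comm n d]
    field_simp

lemma natCast_le_two_pow_mul {q : ℝ} (hq : 2 ≤ q) (b : ℕ) : (b : ℝ) ≤ q ^ b := by
  have h1 : (b : ℝ) ≤ 2 ^ b := by exact_mod_cast Nat.lt_two_pow_self.le
  exact h1.trans (pow_le_pow_left₀ (by norm_num) hq b)

/-- The lower order factors are absorbed into `q ^ (12 n / g)`. -/
lemma lower_order_le {q γ : ℝ} (hq : 2 ≤ q) (hγ : 0 < γ) (hn : 2 ≤ n)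
    (h : γ * q ^ (2 * b) ≤ n / Real.log n) {N : ℕ} (hN : (N : ℝ) = q ^ b) :
    (b : ℝ) * (4 * q ^ (2 * b ^ 2) * ((n : ℝ) + 1) ^ N * q ^ b) ≤ q ^ (12 / γ * n) ∧
      (b : ℝ) + 3 ≤ 12 / γ * n := by
  have hn' : (2 : ℝ) ≤ n := by exact_mod_cast hn
  have hq0 : 0 < q := by linarith
  have hlog2 : (0.69 : ℝ) < Real.log 2 := by linarith [Real.log_two_gt_d9]
  have hlogn : Real.log 2 ≤ Real.log n := Real.log_le_log (by norm_num) hn'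
  have hlogq : Real.log 2 ≤ Real.log q := Real.log_le_log (by norm_num) hq
  have hlogn0 : 0 < Real.log n := by linarith
  rw [le_div_iff₀ hlogn0] at h
  set Y := q ^ (2 * b) with hY
  have hb : (b : ℝ) ≤ q ^ b := natCast_le_two_pow_mul hq b
  have hb1 : 1 ≤ q ^ b := one_le_pow₀ (by linarith)
  have hYb : Y = q ^ b * q ^ b := by rw [hY, two_mul, pow_add]
  have hbY : q ^ b ≤ Y := by nlinarith
  have hb2 : (b : ℝ) ^ 2 ≤ Y := by nlinarith [Nat.cast_nonneg (α := ℝ) b]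
  have hY1 : 1 ≤ Y := hb1.trans hbY
  have hYlog : Y * Real.log n ≤ n / γ := by
    rw [le_div_iff₀ hγ]; linarith
  have hYlog' : 0.69 * Y ≤ Y * Real.log n := by nlinarith
  have e12 : 12 / γ * n = 12 * (n / γ) := by ring
  refine ⟨?_, by rw [e12]; linarith⟩
  have hlogn1 : Real.log ((n : ℝ) + 1) ≤ 2 * Real.log n := by
    rw [← Nat.cast_two, ← Real.log_pow]
    refine Real.log_le_log (by positivity) ?_
    nlinarith
  have hpow : ((n : ℝ) + 1) ^ N ≤ q ^ (3 * (Y * Real.log n)) := by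
    rw [← Real.rpow_natCast, Real.rpow_def_of_pos (by positivity), Real.rpow_def_of_pos hq0,
      Real.exp_le_exp, hN]
    have h1 : Real.log ((n : ℝ) + 1) * q ^ b ≤ 2 * Real.log n * Y :=
      mul_le_mul hlogn1 hbY (by positivity) (by positivity)
    have h2 : 0.69 * (3 * (Y * Real.log n)) ≤ Real.log q * (3 * (Y * Real.log n)) :=
      mul_le_mul_of_nonneg_right (by linarith) (by positivity)
    nlinarith
  have hfour : (4 : ℝ) ≤ q ^ 2 := by nlinarith
  calc (b : ℝ) * (4 * q ^ (2 * b ^ 2) * ((n : ℝ) + 1) ^ N * q ^ b)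
      ≤ q ^ b * (q ^ 2 * q ^ (2 * b ^ 2) * q ^ (3 * (Y * Real.log n)) * q ^ b) := by gcongr
    _ = q ^ (((2 * b + 2 + 2 * b ^ 2 : ℕ) : ℝ) + 3 * (Y * Real.log n)) := by
        rw [Real.rpow_add hq0, Real.rpow_natCast]
        ring
    _ ≤ q ^ (12 / γ * n) := by
        -- Each of `b`, `b ^ 2` and `1` is at most `Y`, so `2 b + 2 + 2 b ^ 2 ≤ 6 Y ≤ (6 / 0.69) Y
        -- log n`; adding `3 Y log n` stays below `12 Y log n ≤ 12 n / γ`.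
        refine Real.rpow_le_rpow_of_exponent_le (by linarith) ?_
        push_cast
        rw [e12]
        linarith

lemma natCard_eq_rpow_designRate (D : LinearCode F m) (hn : 0 < n) :
    (Nat.card D : ℝ) = (Fintype.card F : ℝ) ^ (designRate D n * n) := by
  have hq : (1 : ℝ) < Fintype.card F := by exact_mod_cast Fintype.one_lt_card
  have hn' : (n : ℝ) ≠ 0 := by positivity
  have hD : (0 : ℝ) < Nat.card D := by exact_mod_cast Nat.card_pos
  rw [designRate, div_mul_cancel₀ _ hn', Real.rpow_logb (by linarith) hq.ne' hD]

lemma designRate_nonneg (D : LinearCode F m) : 0 ≤ designRate D n := by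
  have hq : (1 : ℝ) < Fintype.card F := by exact_mod_cast Fintype.one_lt_card
  have hD : (1 : ℝ) ≤ Nat.card D := by exact_mod_cast Nat.card_pos (α := D)
  exact div_nonneg (Real.logb_nonneg hq hD) (Nat.cast_nonneg n)

end Final

/-- Random puncturings of a code of near-optimal distance have the threshold of random linear
codes, with an explicit lower order term. -/
theorem prob_randomPuncturing_le_rpow {F : Type*} [Field F] [Fintype F] {m n b : ℕ}
    [NeZero m] {P : CodeProperty F n}
    (hmono : MonotoneIncreasing P) (hsymm : RowSymmetric P) (hloc : IsLocal b P)
    (hscal : ScalarInvariant P) (D : LinearCode F m)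
    (hD : HasOptimalDistance ((Fintype.card F : ℝ) ^ (-(b : ℝ))) D) {γ ε : ℝ}
    (hγ : 0 < γ) (hn : 2 ≤ n) (hε : 0 < ε)
    (h : γ * (Fintype.card F : ℝ) ^ (2 * b) ≤ n / Real.log n)
    (hR : designRate D n ≤ rlcThreshold P - ε - 2 * Real.logb (Fintype.card F) 2) :
    prob (randomPuncturing D n) P ≤ (Fintype.card F : ℝ) ^ (-((ε - 12 / γ) * n)) := by
  obtain ⟨hlow, hb3⟩ := lower_order_le (b := b) (N := Fintype.card F ^ b)
    (by exact_mod_cast Fintype.one_lt_card (α := F)) hγ hn h (by push_cast; rfl)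
  have hcard := natCard_eq_rpow_designRate (n := n) D (by omega)
  set q : ℝ := (Fintype.card F : ℝ) with hq
  have hq2 : 2 ≤ q := by
    have : 2 ≤ Fintype.card F := Fintype.one_lt_card
    rw [hq]; exact_mod_cast this
  have hq0 : 0 < q := by linarith
  have hn0 : (0 : ℝ) < n := by exact_mod_cast (by omega : 0 < n)
  set ℓ := Real.logb q 2 with hℓ
  have hℓ0 : 0 ≤ ℓ := Real.logb_nonneg (by linarith) (by norm_num)
  have hqℓ : q ^ ℓ = 2 := Real.rpow_logb hq0 (by linarith) (by norm_num)
  have hR0 := designRate_nonneg (n := n) D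
  set x := rlcThreshold P * n with hx
  have hεx : ε * n ≤ x := by
    rw [hx]; exact mul_le_mul_of_nonneg_right (by linarith) hn0.le
  have hx0 : 0 < x := lt_of_lt_of_le (by positivity) hεx
  -- `k` is the largest integer strictly below `RLC(P) n`; the rounding costs one factor `q` in
  -- `hθ`.
  obtain ⟨k, hkc⟩ : ∃ k, ⌈x⌉₊ = k + 1 :=
    Nat.exists_eq_succ_of_ne_zero (Nat.ceil_pos.2 hx0).ne'
  have hkx : (k : ℝ) < x := Nat.lt_ceil.1 (by omega)
  have hxk : x ≤ k + 1 := by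
    have := Nat.le_ceil x
    rw [hkc] at this
    exact_mod_cast this
  by_cases hkb : b + 2 ≤ k
  · refine (prob_randomPuncturing_le_of_lt_half hmono hsymm hloc hscal hkb
      (prob_lt_half_of_lt_rlcThreshold P hkx) D hD).trans ?_
    rw [← hq]
    set ω : ℝ := q ^ (-(ε * n)) / 4 ^ n with hω
    have hω0 : 0 ≤ ω := by positivity
    have hω1 : ω ≤ 1 := by
      rw [hω, div_le_one (by positivity)]
      refine (Real.rpow_le_one_of_one_le_of_nonpos (by linarith) ?_).trans
        (one_le_pow₀ (by norm_num))
      have : 0 < ε * n := by positivity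
      linarith
    have hθ : (Nat.card D : ℝ) / q ^ k ≤ q * ω := by
      have h4 : (4 : ℝ) ^ n = q ^ (2 * ℓ * n) := by
        rw [Real.rpow_mul hq0.le, mul_comm 2 ℓ, Real.rpow_mul hq0.le, hqℓ, Real.rpow_natCast]
        norm_num
      rw [hω, h4, hcard, ← Real.rpow_natCast q k, ← Real.rpow_sub hq0, ← Real.rpow_sub hq0]
      nth_rewrite 2 [← Real.rpow_one q]
      rw [← Real.rpow_add hq0]
      refine Real.rpow_le_rpow_of_exponent_le (by linarith) ?_
      have := mul_le_mul_of_nonneg_right hR hn0.le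
      nlinarith
    have hterm : ∀ d ∈ Finset.Icc 1 b, 4 * q ^ (2 * b ^ 2) *
        ((n : ℝ) + 1) ^ (Fintype.card F ^ d) * 4 ^ n * ((Nat.card D : ℝ) / q ^ k) ^ d ≤
        4 * q ^ (2 * b ^ 2) * ((n : ℝ) + 1) ^ (Fintype.card F ^ b) * q ^ b *
          q ^ (-(ε * n)) := by
      intro d hd
      obtain ⟨hd1, hdb⟩ := Finset.mem_Icc.1 hd
      have h1 : ((Nat.card D : ℝ) / q ^ k) ^ d ≤ q ^ b * ω := by
        refine (pow_le_pow_left₀ (by positivity) hθ d).trans ?_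
        rw [mul_pow]
        refine mul_le_mul (pow_le_pow_right₀ (by linarith) hdb) ?_ (by positivity)
          (by positivity)
        -- Since `d ≥ 1` and `ω ≤ 1`, one factor `ω` is kept; it cancels the `4 ^ n` of the union
        -- bound, which occurs only once for every `d`.
        exact pow_le_of_le_one hω0 hω1 (by omega)
      have h2 : ((n : ℝ) + 1) ^ (Fintype.card F ^ d) ≤ ((n : ℝ) + 1) ^ (Fintype.card F ^ b) :=
        pow_le_pow_right₀ (by linarith) (Nat.pow_le_pow_right Fintype.card_pos hdb)
      calc _ ≤ 4 * q ^ (2 * b ^ 2) * ((n : ℝ) + 1) ^ (Fintype.card F ^ b) * 4 ^ n *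
            (q ^ b * ω) := by gcongr
        _ = _ := by rw [hω]; field_simp
    refine (Finset.sum_le_card_nsmul _ _ _ hterm).trans ?_
    rw [Nat.card_Icc, Nat.add_sub_cancel, nsmul_eq_mul, ← mul_assoc]
    refine (mul_le_mul_of_nonneg_right hlow (by positivity)).trans (le_of_eq ?_)
    rw [← Real.rpow_add hq0]
    congr 1
    ring
  -- When `k ≤ b + 1`, `ε n ≤ x ≤ b + 2 ≤ (12 / γ) n`, so the claimed bound is at least `1`.
  · refine (prob_le_one _ _).trans (Real.one_le_rpow (by linarith) ?_)
    have hk' : (k : ℝ) + 1 ≤ b + 2 := by exact_mod_cast (by omega : k + 1 ≤ b + 2)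
    nlinarith

end LocalCodes

theorem mainTheorem2 (g : ℕ → ℝ) (hg : Tendsto g atTop atTop) :
    ∃ δ : ℕ → ℝ, Tendsto δ atTop (𝓝 0) ∧
      ∀ (F : Type*) [Field F] [Fintype F] (n b : ℕ) (P : LocalCodes.CodeProperty F n),
        g n * (Fintype.card F : ℝ) ^ (2 * b) ≤ (n : ℝ) / Real.log n →
        P.Nonempty →
        LocalCodes.MonotoneIncreasing P →
        LocalCodes.RowSymmetric P →
        LocalCodes.IsLocal b P →
        LocalCodes.ScalarInvariant P →
        ∀ (m : ℕ) [NeZero m] (D : LocalCodes.LinearCode F m) (ε : ℝ),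
          LocalCodes.HasOptimalDistance ((Fintype.card F : ℝ) ^ (-(b : ℝ))) D →
          0 < ε →
          LocalCodes.designRate D n ≤
            LocalCodes.rlcThreshold P - ε - 2 * Real.logb (Fintype.card F) 2 →
          LocalCodes.prob (LocalCodes.randomPuncturing D n) P ≤
            (Fintype.card F : ℝ) ^ (-((ε - δ n) * n)) := by
  classical
  -- The value `1` is used for only finitely many `n`. There the rate hypothesis forces `ε ≤ RLC(P)
  -- ≤ 1`, so the exponent is nonnegative and the bound trivial.
  refine ⟨fun n => if 2 ≤ n ∧ 0 < g n then 12 / g n else 1, ?_, ?_⟩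
  · refine Tendsto.congr' ?_ (hg.const_div_atTop 12)
    filter_upwards [eventually_ge_atTop 2, hg.eventually_gt_atTop 0] with n h1 h2
    rw [if_pos ⟨h1, h2⟩]
  · intro F _ _ n b P h _ hmono hsymm hloc hscal m _ D ε hD hε hR
    by_cases hn : 2 ≤ n ∧ 0 < g n
    · simp only [if_pos hn]
      exact LocalCodes.prob_randomPuncturing_le_rpow hmono hsymm hloc hscal D hD hn.2 hn.1 hε h hR
    · simp only [if_neg hn]
      have hq : (1 : ℝ) < Fintype.card F := by exact_mod_cast Fintype.one_lt_card
      have hℓ : 0 ≤ Real.logb (Fintype.card F) 2 := Real.logb_nonneg hq (by norm_num)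
      have h1 := LocalCodes.rlcThreshold_le_one P
      have h2 := LocalCodes.designRate_nonneg (n := n) D
      refine (LocalCodes.prob_le_one _ _).trans (Real.one_le_rpow hq.le ?_)
      have : 0 ≤ (1 - ε) * n := mul_nonneg (by linarith) (Nat.cast_nonneg n)
      linarith
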